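/- Let $n\ge 3$ be a finite ordinal. Consider algebras that consist of a Boolean algebra together with the following extra operations ($i,j<n$): unary ${\sf c}_i$ (diagonal-free type $\mathsf{Df}_n$); ${\sf c}_i$ and constants ${\sf d}_{ij}$ (cylindric type $\mathsf{CA}_n$); unary ${\sf c}_i,{\sf s}^i_j,{\sf p}_{ij}$ (polyadic type $\mathsf{PA}_n$); ${\sf c}_i,{\sf s}^i_j,{\sf p}_{ij}$ and ${\sf d}_{ij}$ (polyadic equality type $\mathsf{PEA}_n$). For a set $U$, the full set algebra of $\mathsf{CA}$, $\mathsf{PA}$ or $\mathsf{PEA}$ type with base $U$ has as elements all subsets of ${}^nU$, with the set-theoretic Boolean operations and those of the operations $${\sf c}_iX=\{s:\exists t\in X\ \forall k\neq i\ (t_k=s_k)\},\quad {\sf d}_{ij}=\{s:s_i=s_j\},\quad {\sf s}^i_jX=\{s: s\circ[i/j]\in X\},\quad {\sf p}_{ij}X=\{s\circ[i,j]:s\in X\}$$ that belong to the type, where $[i/j]$ maps $i$ to $j$ and fixes every other index, and $[i,j]$ is the transposition; a full set algebra of $\mathsf{Df}$ type consists of all subsets of a product $U_0\times\dots\times U_{n-1}$,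 with the operations ${\sf c}_i$. A set algebra is a subalgebra of a full set algebra, and an algebra is representable if it is isomorphic to a subdirect product of set algebras of its type; $\mathsf{RCA}_n$, $\mathsf{RPEA}_n$, $\mathsf{RPA}_n$, $\mathsf{RDf}_n$ denote the classes of representable algebras of the respective types. A completion of $\mathfrak A$ is an algebra $\mathfrak C$ of the same type whose Boolean part is complete, whose unary operations ${\sf c}_i$ (and ${\sf s}^i_j,{\sf p}_{ij}$, if present) distribute over arbitrary joins, and in which $\mathfrak A$ embeds as a dense subalgebra (every nonzero element of $\mathfrak C$ is above the image of a nonzero element of $\mathfrak A$). Then none of the classes $\mathsf{RCA}_n$, $\mathsf{RPEA}_n$, $\mathsf{RPA}_n$, $\mathsf{RDf}_n$ is closed under completions. Moreover, one example serves for all four: there are a countable atomic algebra $\mathfrak A$ of type $\mathsf{PEA}_n$ and a completion $\mathfrak C$ of $\mathfrak A$ such that, for each $\mathsf K\in\{\mathsf{CA},\mathsf{PEA},\mathsf{PA},\mathsf{Df}\}$, the $\mathsf K_n$-type reduct of $\mathfrak A$ is representable, the $\mathsf K_n$-type reduct of $\mathfrak C$ is a completion of the $\mathsf K_n$-type reduct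 of $\mathfrak A$, and the $\mathsf K_n$-type reduct of $\mathfrak C$ is not representable. -/

import Mathlib

universe u

namespace AlgLogic

/-- A similarity type of Boolean algebras with operators: the symbols for the unary operators and
the symbols for the distinguished constants (the Boolean operations are always present). -/
structure Sig where
  Op : Type
  Const : Type

/-- An algebra of similarity type `S`: a Boolean algebra with unary operations and constants. -/
structure Alg (S : Sig) where
  carrier : Type u
  [boolAlg : BooleanAlgebra carrier]
  op : S.Op → carrier → carrier
  const : S.Const → carrier

namespace Alg

variable {S T : Sig}

instance : CoeSort (Alg.{u} S) (Type u) := ⟨Alg.carrier⟩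

instance (A : Alg.{u} S) : BooleanAlgebra A := A.boolAlg

/-- Homomorphisms: maps preserving the Boolean operations (a bounded lattice homomorphism between
Boolean algebras preserves complements), the operators and the constants. -/
structure Hom (A B : Alg.{u} S) extends BoundedLatticeHom A B where
  map_op : ∀ (f : S.Op) (a : A), toFun (A.op f a) = B.op f (toFun a)
  map_const : ∀ k : S.Const, toFun (A.const k) = B.const k

instance (A B : Alg.{u} S) : CoeFun (Hom A B) (fun _ => A → B) := ⟨fun h => h.toFun⟩

/-- The reduct of an algebra along a renaming of operator and constant symbols. -/
def reduct (f : S.Op → T.Op) (g : S.Const → T.Const) (A : Alg.{u} T) : Alg.{u} S where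
  carrier := A
  op := fun o => A.op (f o)
  const := fun k => A.const (g k)

/-- The Boolean part of `C` is complete: every set of elements has a supremum. -/
def IsCompleteBoolean (C : Alg.{u} S) : Prop :=
  ∀ X : Set C, ∃ x : C, IsLUB X x

/-- Every operator of `C` distributes over all existing suprema. -/
def IsCompletelyAdditive (C : Alg.{u} S) : Prop :=
  ∀ (f : S.Op) (X : Set C) (x : C), IsLUB X x → IsLUB (C.op f '' X) (C.op f x)

/-- `C` is a completion (minimal completion, Dedekind-MacNeille completion, Monk completion)
of `A`: it is a complete Boolean algebra with completely additive operators, in which `A` embeds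
as a dense subalgebra. -/
def IsCompletion (A C : Alg.{u} S) : Prop :=
  C.IsCompleteBoolean ∧ C.IsCompletelyAdditive ∧
    ∃ e : Hom A C, Function.Injective e ∧
      ∀ c : C, c ≠ ⊥ → ∃ a : A, a ≠ ⊥ ∧ e a ≤ c

/-- A class of similar algebras is closed under completions. -/
def ClosedUnderCompletions (K : Set (Alg.{u} S)) : Prop :=
  ∀ A ∈ K, ∀ C : Alg.{u} S, IsCompletion A C → C ∈ K

/-- Isomorphic copies of subalgebras of members of `K`. -/
def SubalgebrasOf (K : Set (Alg.{u} S)) : Set (Alg.{u} S) :=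
  {A | ∃ B ∈ K, ∃ e : Hom A B, Function.Injective e}

/-- Isomorphic copies of subdirect products of members of `K`. -/
def SubdirectProductsOf (K : Set (Alg.{u} S)) : Set (Alg.{u} S) :=
  {A | ∃ (I : Type u) (B : I → Alg.{u} S) (h : ∀ i, Hom A (B i)),
    (∀ i, B i ∈ K) ∧ (∀ i, Function.Surjective (h i)) ∧
      ∀ a b : A, (∀ i, h i a = h i b) → a = b}

end Alg

/-! ### The four similarity types in dimension `n` -/

/-- Operators of diagonal-free and of cylindric algebras: the cylindrifications `c_i`. -/
inductive CylOp (n : ℕ) : Type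
  | c (i : Fin n)

/-- Operators of polyadic algebras: the cylindrifications `c_i`, the substitutions `s^i_j`
(replace `i` by `j`) and the transpositions `p_ij`. -/
inductive PolyOp (n : ℕ) : Type
  | c (i : Fin n)
  | s (i j : Fin n)
  | p (i j : Fin n)

/-- The diagonal elements `d_ij`. -/
inductive Diag (n : ℕ) : Type
  | d (i j : Fin n)

/-- Diagonal-free cylindric algebras: `c_i`. -/
def sigDf (n : ℕ) : Sig := ⟨CylOp n, Empty⟩

/-- Cylindric algebras: `c_i`, `d_ij`. -/
def sigCA (n : ℕ) : Sig := ⟨CylOp n, Diag n⟩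

/-- Polyadic algebras (without equality): `c_i`, `s^i_j`, `p_ij`. -/
def sigPA (n : ℕ) : Sig := ⟨PolyOp n, Empty⟩

/-- Polyadic equality algebras: `c_i`, `s^i_j`, `p_ij`, `d_ij`. -/
def sigPEA (n : ℕ) : Sig := ⟨PolyOp n, Diag n⟩

def cylToPoly {n : ℕ} : CylOp n → PolyOp n
  | .c i => .c i

/-- The cylindric reduct of an algebra of polyadic equality type. -/
def rdCA {n : ℕ} (A : Alg.{u} (sigPEA n)) : Alg.{u} (sigCA n) :=
  Alg.reduct (S := sigCA n) (T := sigPEA n) cylToPoly id A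

/-- The polyadic (equality-free) reduct of an algebra of polyadic equality type. -/
def rdPA {n : ℕ} (A : Alg.{u} (sigPEA n)) : Alg.{u} (sigPA n) :=
  Alg.reduct (S := sigPA n) (T := sigPEA n) id Empty.elim A

/-- The diagonal-free reduct of an algebra of polyadic equality type. -/
def rdDf {n : ℕ} (A : Alg.{u} (sigPEA n)) : Alg.{u} (sigDf n) :=
  Alg.reduct (S := sigDf n) (T := sigPEA n) cylToPoly Empty.elim A

/-! ### Operations on sets of `n`-tuples -/

/-- `C_i X`: the tuples that agree with some member of `X` off the coordinate `i`. -/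
def setCyl {n : ℕ} {U : Fin n → Type u} (i : Fin n) (X : Set (∀ k, U k)) : Set (∀ k, U k) :=
  {x | ∃ y ∈ X, ∀ k, k ≠ i → y k = x k}

/-- `S^i_j X`: the tuples that fall into `X` when the `i`-th entry is replaced by the `j`-th. -/
def setSub {n : ℕ} {U : Type u} (i j : Fin n) (X : Set (Fin n → U)) : Set (Fin n → U) :=
  {x | Function.update x i (x j) ∈ X}

/-- `P_ij X = {s ∘ [i,j] : s ∈ X}`. -/
def setPerm {n : ℕ} {U : Type u} (i j : Fin n) (X : Set (Fin n → U)) : Set (Fin n → U) :=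
  (fun x : Fin n → U => x ∘ Equiv.swap i j) '' X

/-- `D_ij`: the tuples whose `i`-th and `j`-th entries coincide. -/
def setDiag {n : ℕ} {U : Type u} (i j : Fin n) : Set (Fin n → U) :=
  {x | x i = x j}

/-- `C_i`, `S^i_j`, `P_ij` on the subsets of `U^n`. -/
def setPolyOp {n : ℕ} {U : Type u} : PolyOp n → Set (Fin n → U) → Set (Fin n → U)
  | .c i => setCyl i
  | .s i j => setSub i j
  | .p i j => setPerm i j

/-! ### Full set algebras -/

/-- The full diagonal-free set algebra with unit the product `U_0 × ⋯ × U_{n-1}`. -/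
def fullDf (n : ℕ) (U : Fin n → Type u) : Alg.{u} (sigDf n) where
  carrier := Set (∀ k, U k)
  op := fun | .c i => setCyl i
  const := Empty.elim

/-- The full cylindric set algebra with unit `U^n`. -/
def fullCA (n : ℕ) (U : Type u) : Alg.{u} (sigCA n) where
  carrier := Set (Fin n → U)
  op := fun | .c i => setCyl i
  const := fun | .d i j => setDiag i j

/-- The full polyadic set algebra with unit `U^n`. -/
def fullPA (n : ℕ) (U : Type u) : Alg.{u} (sigPA n) where
  carrier := Set (Fin n → U)
  op := setPolyOp
  const := Empty.elim

/-- The full polyadic equality set algebra with unit `U^n`. -/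
def fullPEA (n : ℕ) (U : Type u) : Alg.{u} (sigPEA n) where
  carrier := Set (Fin n → U)
  op := setPolyOp
  const := fun | .d i j => setDiag i j

/-! ### Representable algebras: isomorphic to subdirect products of set algebras, a set algebra
being a subalgebra of a full set algebra -/

/-- Representable diagonal-free cylindric algebras of dimension `n`. -/
def RDf (n : ℕ) : Set (Alg.{u} (sigDf n)) :=
  Alg.SubdirectProductsOf (Alg.SubalgebrasOf (Set.range (fullDf.{u} n)))

/-- Representable cylindric algebras of dimension `n`. -/
def RCA (n : ℕ) : Set (Alg.{u} (sigCA n)) :=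
  Alg.SubdirectProductsOf (Alg.SubalgebrasOf (Set.range (fullCA.{u} n)))

/-- Representable polyadic algebras of dimension `n`. -/
def RPA (n : ℕ) : Set (Alg.{u} (sigPA n)) :=
  Alg.SubdirectProductsOf (Alg.SubalgebrasOf (Set.range (fullPA.{u} n)))

/-- Representable polyadic equality algebras of dimension `n`. -/
def RPEA (n : ℕ) : Set (Alg.{u} (sigPEA n)) :=
  Alg.SubdirectProductsOf (Alg.SubalgebrasOf (Set.range (fullPEA.{u} n)))

end AlgLogic

/-!
The algebras are built from *patterns*, the complete types of `n`-tuples in structures whose finite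
sets of points are labelled by a colour, from a finite set, and a vertex of the disjoint union of
infinitely many finite cliques. The restriction on the labels is that the `n` facets of a set with
`n` elements, if they all have the same colour, include two whose vertices are adjacent.
There is one further vertex, a limit point of the cliques, which counts as adjacent to itself. A
pattern is *real* if the limit point does not occur in it.

The algebra `approxAlg` consists of the sets of patterns that ignore all but finitely many cliques,
that is, do not distinguish the vertices of the remaining cliques from the limit point. It is closed
under cylindrification since a tuple has a single facet without the entry `i`: the labels of all
other facets may be changed together with that entry (`Close.exists_sim`). Every member is
determined by the real patterns in it, as limit points can be replaced by distinct vertices of a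
clique far away (`Pattern.fill`), and real patterns are isolated. Hence the complex algebra
`realAlg` of the real patterns is a completion of `approxAlg` (`realAlg_isCompletion`).

The algebra `approxAlg` is representable: a structure that realizes every pattern, and extends its
tuples in every way that patterns allow, is built one point at a time (`IsPoint`,
`exists_typeOf_eq`). The sets that contain a new point but are not prescribed get the limit point,
in an unused colour. This never violates the restriction on labels (`exists_adj_facets`), as the
limit point is adjacent to itself.

The completion contains the joins over all cliques, so that in a representation of `realAlg` all
labels would fall into finitely many classes, each given by a colour and a position in the cliques,
and vertices at the same position are never adjacent. But a representation, even of the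
diagonal-free reduct, contains infinitely many distinct points (`exists_distinct_points`), so by a
Ramsey argument (`exists_monochromatic_facets`) it has `n` of them all of whose facets are in the
same class, which contradicts the restriction on labels (`not_representable`). Without diagonals in
the language, the diagonal elements still serve to identify points of different factors of the unit.
-/

namespace AlgLogic

/-! ### A Ramsey theorem for facets -/

/-- A limit, along a nonprincipal ultrafilter, of a function with finitely many values. -/
theorem exists_ultrafilter_limit {κ : Type*} [Finite κ] (f : ℕ → κ) :
    ∃ c, ∀ᶠ x in (Filter.hyperfilter ℕ : Filter ℕ), f x = c :=
  Ultrafilter.eventually_exists_iff.1 (Filter.Eventually.of_forall fun x => ⟨f x, rfl⟩)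

/-- The iterated ultrafilter limit of `χ (x_k :: ⋯ :: x_1 :: l)`, the innermost limit being taken
over the variable at the head. -/
noncomputable def iterLimit {κ : Type*} [Finite κ] (χ : List ℕ → κ) : ℕ → List ℕ → κ
  | 0, l => χ l
  | k + 1, l => (exists_ultrafilter_limit fun x => iterLimit χ k (x :: l)).choose

theorem iterLimit_succ {κ : Type*} [Finite κ] (χ : List ℕ → κ) (k : ℕ) (l : List ℕ) :
    ∀ᶠ x in (Filter.hyperfilter ℕ : Filter ℕ),
      iterLimit χ k (x :: l) = iterLimit χ (k + 1) l :=
  (exists_ultrafilter_limit fun x => iterLimit χ k (x :: l)).choose_spec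

/-- Arbitrarily long lists all of whose short sublists have the same iterated limit: the next entry
only has to lie in finitely many sets of the ultrafilter. -/
theorem exists_homogeneous_list {κ : Type*} [Finite κ] (χ : List ℕ → κ) (m N : ℕ) :
    ∃ P : List ℕ, P.length = N ∧ P.Nodup ∧
      ∀ l : List ℕ, l.Sublist P → ∀ k, l.length + k = m →
        iterLimit χ k l = iterLimit χ m [] := by
  induction N with
  | zero =>
    refine ⟨[], rfl, List.nodup_nil, fun l hl k hk => ?_⟩
    obtain rfl := List.sublist_nil.1 hl
    simp at hk
    rw [hk]
  | succ N ih =>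
    obtain ⟨P, hlen, hnd, hP⟩ := ih
    have h1 : ∀ᶠ x in (Filter.hyperfilter ℕ : Filter ℕ), x ∉ P :=
      Filter.mem_of_superset
        (Filter.hyperfilter_le_cofinite P.toFinset.finite_toSet.compl_mem_cofinite)
        fun x hx h => hx (by simpa using h)
    have h2 : ∀ᶠ x in (Filter.hyperfilter ℕ : Filter ℕ),
        ∀ l ∈ P.sublists.toFinset, ∀ k ∈ Finset.range (m + 1),
          iterLimit χ k (x :: l) = iterLimit χ (k + 1) l := by
      rw [Filter.eventually_all_finset]
      intro l _
      rw [Filter.eventually_all_finset]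
      intro k _
      exact iterLimit_succ χ k l
    obtain ⟨x, hx1, hx2⟩ := (h1.and h2).exists
    refine ⟨x :: P, by simp [hlen], List.nodup_cons.2 ⟨hx1, hnd⟩, fun l hl k hk => ?_⟩
    rcases List.sublist_cons_iff.1 hl with h | ⟨r, rfl, h⟩
    · exact hP l h k hk
    · simp only [List.length_cons] at hk
      rw [hx2 r (by simpa using h) k (by simp; omega)]
      exact hP r h (k + 1) (by omega)

/-- If the `m`-tuples of natural numbers are coloured with finitely many colours, then some
`(m + 1)`-tuple of distinct numbers has all its facets of the same colour. -/
theorem exists_monochromatic_facets {κ : Type*} [Finite κ] (m : ℕ) (χ : (Fin m → ℕ) → κ) :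
    ∃ g : Fin (m + 1) → ℕ, Function.Injective g ∧ ∃ c, ∀ i : Fin (m + 1),
      χ (fun k => g (i.succAbove k)) = c := by
  let χ' : List ℕ → κ := fun l => χ fun i => l.getD i 0
  obtain ⟨P, hlen, hnd, hP⟩ := exists_homogeneous_list χ' m (m + 1)
  refine ⟨fun i => P.get (i.cast hlen.symm), fun i j h => ?_, iterLimit χ' m [], fun i => ?_⟩
  · have := List.nodup_iff_injective_get.1 hnd h
    simpa [Fin.ext_iff] using this
  · have hsub : (List.ofFn fun k => P.get ((i.succAbove k).cast hlen.symm)).Sublist P := by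
      rw [List.sublist_iff_exists_fin_orderEmbedding_get_eq]
      refine ⟨OrderEmbedding.ofStrictMono (fun k => ((i.succAbove (k.cast (by simp))).cast
        hlen.symm)) ?_, ?_⟩
      · intro a b hab
        have : i.succAbove (a.cast (by simp)) < i.succAbove (b.cast (by simp)) :=
          Fin.strictMono_succAbove i (Fin.lt_def.2 hab)
        exact this
      · intro k
        simp [Fin.cast]
    have := hP _ hsub 0 (by simp)
    rw [← this]
    change χ _ = χ _
    congr 1
    funext k
    simp [List.getD_eq_getElem?_getD]

/-! ### Patterns -/

/-- The colours that occur in labels. There are more of them than there are sets of indices. -/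
abbrev Col (n : ℕ) : Type := Option (Finset (Fin n))

/-- The vertices of a graph that is the disjoint union of the cliques `{m} × Finset (Fin n)`,
together with a limit point `none`. -/
abbrev Vert (n : ℕ) : Type := Option (ℕ × Finset (Fin n))

/-- Adjacency of vertices: distinct vertices of the same clique are adjacent, and the limit point is
adjacent to itself only. -/
def Adj {n : ℕ} : Vert n → Vert n → Prop
  | none, none => True
  | some (m, S), some (m', S') => m = m' ∧ S ≠ S'
  | _, _ => False

/-- The label of sets with at most one element. -/
def defaultLabel (n : ℕ) : Col n × Vert n := (none, some (0, ∅))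

/-- Complete types of `n`-tuples in a structure whose finite sets of points are labelled by a
colour and a vertex: `r i j` says that the entries `i` and `j` coincide, and `K S` is the label of
the set of the entries with index in `S`. Sets with at most one element have a default label. The
only further restriction on the labelling is that, if the facets of a set with `n` elements all have
the same colour, then the vertices of two of them are adjacent. -/
@[ext]
structure Pattern (n : ℕ) : Type u where
  r : Fin n → Fin n → Prop
  K : Finset (Fin n) → Col n × Vert n
  equiv : Equivalence r
  inv : ∀ S T : Finset (Fin n), (∀ s ∈ S, ∃ t ∈ T, r s t) → (∀ t ∈ T, ∃ s ∈ S, r t s) → K S = K T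
  sub : ∀ S : Finset (Fin n), (∀ s ∈ S, ∀ t ∈ S, r s t) → K S = defaultLabel n
  con : (∀ i j, r i j → i = j) → ∀ c, (∀ i, (K {i}ᶜ).1 = c) →
    ∃ i j, i ≠ j ∧ Adj (K {i}ᶜ).2 (K {j}ᶜ).2

namespace Pattern

variable {n : ℕ}

/-- The type of `x ∘ f`, for a tuple `x` of the given type. -/
def act (f : Fin n → Fin n) (a : Pattern.{u} n) : Pattern.{u} n where
  r i j := a.r (f i) (f j)
  K S := a.K (S.image f)
  equiv := ⟨fun _ => a.equiv.refl _, a.equiv.symm, a.equiv.trans⟩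
  inv S T h1 h2 := by
    apply a.inv <;> simp only [Finset.mem_image, forall_exists_index, and_imp,
      forall_apply_eq_imp_iff₂, exists_exists_and_eq_and]
    · exact h1
    · exact h2
  sub S h := by
    apply a.sub
    simp only [Finset.mem_image, forall_exists_index, and_imp, forall_apply_eq_imp_iff₂]
    exact h
  con h c hc := by
    have hf : Function.Injective f := fun i j hij => h i j (by rw [hij]; exact a.equiv.refl _)
    have hs : Function.Surjective f := Finite.surjective_of_injective hf
    have him : ∀ i, ({i}ᶜ : Finset (Fin n)).image f = {f i}ᶜ := fun i => by
      ext k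
      obtain ⟨k, rfl⟩ := hs k
      simp [hf.eq_iff]
    simp only [him] at hc ⊢
    obtain ⟨i, j, hij, hadj⟩ := a.con (fun i j hij => by
      obtain ⟨i, rfl⟩ := hs i
      obtain ⟨j, rfl⟩ := hs j
      rw [h i j hij]) c (fun i => by obtain ⟨i, rfl⟩ := hs i; exact hc i)
    obtain ⟨i, rfl⟩ := hs i
    obtain ⟨j, rfl⟩ := hs j
    exact ⟨i, j, fun h => hij (by rw [h]), hadj⟩

theorem act_id (a : Pattern.{u} n) : act id a = a := by
  ext1
  · rfl
  · funext S
    simp [act]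

/-- Two patterns agree off the index `i`. -/
def Sim (i : Fin n) (a b : Pattern.{u} n) : Prop :=
  (∀ j k, j ≠ i → k ≠ i → (a.r j k ↔ b.r j k)) ∧ ∀ S, i ∉ S → a.K S = b.K S

/-- The map `[i/j]` on indices. -/
abbrev repl (i j : Fin n) : Fin n → Fin n := Function.update id i j

/-- The patterns that agree with `b` off `i` and make the entry `i` equal to another entry `j` are
determined by `b`. -/
theorem eq_act_repl {i j : Fin n} (hij : j ≠ i) {a b : Pattern.{u} n} (h : Sim i a b)
    (hr : a.r i j) : a = act (repl i j) b := by
  have hne : ∀ k, repl i j k ≠ i := fun k => by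
    by_cases hk : k = i
    · subst hk; simpa using hij
    · simpa [Function.update_of_ne hk] using hk
  have hrep : ∀ k, a.r k (repl i j k) := fun k => by
    by_cases hk : k = i
    · subst hk; simpa using hr
    · have : repl i j k = k := Function.update_of_ne hk _ _
      rw [this]; exact a.equiv.refl _
  ext1
  · funext k l
    change a.r k l = b.r _ _
    rw [← h.1 _ _ (hne k) (hne l), eq_iff_iff]
    exact ⟨fun hkl => a.equiv.trans (a.equiv.symm (hrep k)) (a.equiv.trans hkl (hrep l)),
      fun hkl => a.equiv.trans (hrep k) (a.equiv.trans hkl (a.equiv.symm (hrep l)))⟩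
  · funext S
    change a.K S = b.K _
    rw [← h.2 _ (by
      intro hi
      obtain ⟨k, -, hk⟩ := Finset.mem_image.1 hi
      exact hne k hk)]
    apply a.inv
    · intro s hs
      exact ⟨_, Finset.mem_image_of_mem _ hs, hrep s⟩
    · intro t ht
      obtain ⟨k, hk, rfl⟩ := Finset.mem_image.1 ht
      exact ⟨k, hk, a.equiv.symm (hrep k)⟩

/-- Replacing the entry `i` by the entry `j` changes the pattern at `i` only. -/
theorem sim_act_repl (i j : Fin n) (a : Pattern.{u} n) : Sim i (act (repl i j) a) a := by
  constructor
  · intro k l hk hl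
    simp [act, Function.update_of_ne hk, Function.update_of_ne hl]
  · intro S hS
    change a.K _ = a.K S
    congr 1
    rw [Finset.image_congr (g := id), Finset.image_id]
    intro k hk
    exact Function.update_of_ne (fun h => hS (by rwa [h] at hk)) _ _

/-- A pattern without limit points among its labels. -/
def Real (a : Pattern.{u} n) : Prop := ∀ S, (a.K S).2 ≠ none

theorem Real.act {a : Pattern.{u} n} (h : a.Real) (f : Fin n → Fin n) : (a.act f).Real :=
  fun S => h (S.image f)

end Pattern

/-! ### Complex algebras -/

/-- The polyadic operations on the sets of elements of a structure with accessibility relations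
`sim i` and an action `act` of the maps on indices. -/
def frameOp {n : ℕ} {X : Type u} (sim : Fin n → X → X → Prop) (act : (Fin n → Fin n) → X → X) :
    PolyOp n → Set X → Set X
  | .c i, Y => {a | ∃ b ∈ Y, sim i b a}
  | .s i j, Y => {a | act (Function.update id i j) a ∈ Y}
  | .p i j, Y => {a | act (Equiv.swap i j) a ∈ Y}

theorem frameOp_isLUB {n : ℕ} {X : Type u} (sim : Fin n → X → X → Prop)
    (act : (Fin n → Fin n) → X → X) (f : PolyOp n) (Z : Set (Set X)) (Y : Set X)
    (h : IsLUB Z Y) : IsLUB (frameOp sim act f '' Z) (frameOp sim act f Y) := by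
  have hY : Y = ⋃₀ Z := h.unique (isLUB_sSup Z)
  subst hY
  have : frameOp sim act f (⋃₀ Z) = sSup (frameOp sim act f '' Z) := by
    rw [Set.sSup_eq_sUnion]
    cases f <;> ext a <;> simp only [frameOp, Set.mem_sUnion, Set.mem_ofPred_eq,
      Set.sUnion_image, Set.mem_iUnion, exists_prop]
    exact ⟨fun ⟨b, ⟨t, ht, hb⟩, hab⟩ => ⟨t, ht, b, hb, hab⟩,
      fun ⟨t, ht, b, hb, hab⟩ => ⟨b, ⟨t, ht, hb⟩, hab⟩⟩
  rw [this]
  exact isLUB_sSup _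

/-! ### Real patterns approximate arbitrary patterns -/

namespace Pattern

variable {n : ℕ}

open Classical in
/-- The saturation of the set `S` with respect to the relation `r`. -/
noncomputable def sat (r : Fin n → Fin n → Prop) (S : Finset (Fin n)) : Finset (Fin n) :=
  Finset.univ.filter fun l => ∃ s ∈ S, r s l

theorem mem_sat {r : Fin n → Fin n → Prop} {S : Finset (Fin n)} {l : Fin n} :
    l ∈ sat r S ↔ ∃ s ∈ S, r s l := by
  simp [sat]

theorem sat_congr {r : Fin n → Fin n → Prop} (hr : Equivalence r) {S T : Finset (Fin n)}
    (h1 : ∀ s ∈ S, ∃ t ∈ T, r s t) (h2 : ∀ t ∈ T, ∃ s ∈ S, r t s) : sat r S = sat r T := by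
  ext l
  simp only [mem_sat]
  constructor
  · rintro ⟨s, hs, hl⟩
    obtain ⟨t, ht, hst⟩ := h1 s hs
    exact ⟨t, ht, hr.trans (hr.symm hst) hl⟩
  · rintro ⟨s, hs, hl⟩
    obtain ⟨t, ht, hst⟩ := h2 s hs
    exact ⟨t, ht, hr.trans (hr.symm hst) hl⟩

theorem sat_eq_self {r : Fin n → Fin n → Prop} (hr : Equivalence r) (h : ∀ i j, r i j → i = j)
    (S : Finset (Fin n)) : sat r S = S := by
  ext l
  simp only [mem_sat]
  exact ⟨fun ⟨s, hs, hl⟩ => h _ _ hl ▸ hs, fun hl => ⟨l, hl, hr.refl l⟩⟩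

/-- Replace a limit point by a vertex of the clique `m`. -/
def fillVert (m : ℕ) (S : Finset (Fin n)) : Vert n → Vert n
  | none => some (m, S)
  | some v => some v

/-- Replace all limit points in a pattern by vertices of the clique `m`, distinct ones for distinct
sets of entries. As limit points are mutually adjacent, this leads to a pattern again. -/
noncomputable def fill (m : ℕ) (a : Pattern.{u} n) : Pattern.{u} n where
  r := a.r
  K S := ((a.K S).1, fillVert m (sat a.r S) (a.K S).2)
  equiv := a.equiv
  inv S T h1 h2 := by rw [a.inv S T h1 h2, sat_congr a.equiv h1 h2]
  sub S h := by rw [a.sub S h]; rfl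
  con h c hc := by
    obtain ⟨i, j, hij, hadj⟩ := a.con h c hc
    refine ⟨i, j, hij, ?_⟩
    rw [sat_eq_self a.equiv h, sat_eq_self a.equiv h]
    rcases hi : (a.K {i}ᶜ).2 with _ | v <;> rcases hj : (a.K {j}ᶜ).2 with _ | w <;>
      rw [hi, hj] at hadj
    · exact ⟨rfl, fun he => hij (Finset.singleton_injective (compl_injective he))⟩
    · exact hadj.elim
    · exact hadj.elim
    · exact hadj

theorem fill_real (m : ℕ) (a : Pattern.{u} n) : (fill m a).Real := by
  intro S
  change fillVert m (sat a.r S) (a.K S).2 ≠ none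
  rcases (a.K S).2 with _ | v <;> simp [fillVert]

theorem Sim.fill {i : Fin n} {a b : Pattern.{u} n} (h : Sim i a b) (hb : b.Real) (m : ℕ) :
    Sim i (fill m a) b := by
  refine ⟨h.1, fun S hS => ?_⟩
  change ((a.K S).1, fillVert m (sat a.r S) (a.K S).2) = _
  rw [h.2 S hS]
  rcases hv : (b.K S).2 with _ | v
  · exact (hb S hv).elim
  · rw [fillVert, ← hv]

/-- Identify the vertices outside of the cliques `0, …, N` with the limit point. -/
def trunc (N : ℕ) : Vert n → Vert n
  | none => none
  | some v => if v.1 ≤ N then some v else none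

theorem trunc_trunc {N M : ℕ} (h : N ≤ M) (v : Vert n) : trunc N (trunc M v) = trunc N v := by
  rcases v with _ | ⟨m, S⟩
  · rfl
  · by_cases hm : m ≤ M
    · simp [trunc, hm]
    · have : ¬ m ≤ N := by omega
      simp [trunc, hm, this]

/-- Two patterns differ only in vertices outside of the cliques `0, …, N`. -/
def Close (N : ℕ) (a b : Pattern.{u} n) : Prop :=
  a.r = b.r ∧ ∀ S, (a.K S).1 = (b.K S).1 ∧ trunc N (a.K S).2 = trunc N (b.K S).2

theorem Close.mono {N M : ℕ} (h : N ≤ M) {a b : Pattern.{u} n} (hab : Close M a b) :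
    Close N a b :=
  ⟨hab.1, fun S => ⟨(hab.2 S).1, by
    rw [← trunc_trunc h, (hab.2 S).2, trunc_trunc h]⟩⟩

theorem Close.symm {N : ℕ} {a b : Pattern.{u} n} (h : Close N a b) : Close N b a :=
  ⟨h.1.symm, fun S => ⟨(h.2 S).1.symm, (h.2 S).2.symm⟩⟩

theorem Close.act {N : ℕ} {a b : Pattern.{u} n} (h : Close N a b) (f : Fin n → Fin n) :
    Close N (act f a) (act f b) :=
  ⟨by simp only [Pattern.act, h.1], fun S => h.2 (S.image f)⟩

theorem close_fill {N m : ℕ} (h : N < m) (a : Pattern.{u} n) : Close N a (fill m a) := by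
  refine ⟨rfl, fun S => ⟨rfl, ?_⟩⟩
  change _ = trunc N (fillVert m (sat a.r S) (a.K S).2)
  rcases (a.K S).2 with _ | v
  · simp [trunc, fillVert, h]
  · rfl

/-- A real pattern is isolated. -/
theorem Real.exists_close_imp_eq {a : Pattern.{u} n} (ha : a.Real) :
    ∃ N, ∀ b, Close N a b → a = b := by
  let N : ℕ := Finset.univ.sup fun S => ((a.K S).2.elim 0 Prod.fst)
  refine ⟨N, fun b hb => ?_⟩
  ext1
  · exact hb.1
  · funext S
    refine Prod.ext (hb.2 S).1 ?_
    have hN : (a.K S).2.elim 0 Prod.fst ≤ N :=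
      Finset.le_sup (f := fun S => ((a.K S).2.elim 0 Prod.fst)) (Finset.mem_univ S)
    have := (hb.2 S).2
    rcases hv : (a.K S).2 with _ | v
    · exact (ha S hv).elim
    · rw [hv] at this hN
      have hN' : v.1 ≤ N := hN
      rcases hw : (b.K S).2 with _ | w
      · simp [trunc, hw, hN'] at this
      · by_cases h : w.1 ≤ N
        · simpa [trunc, hw, hN', h] using this
        · simp [trunc, hw, hN', h] at this

/-- Another vertex of the clique of a vertex outside of the cliques `0, …, N`; the limit point for
all other vertices. -/
def partner (N : ℕ) : Vert n → Vert n
  | none => none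
  | some (m, S) => if m ≤ N then none else some (m, Sᶜ)

/-- Replace the vertices outside of the cliques `0, …, N` by `w`. -/
def replaceFar (N : ℕ) (w : Vert n) : Vert n → Vert n
  | none => w
  | some v => if v.1 ≤ N then some v else w

theorem trunc_partner (N : ℕ) (v : Vert n) : trunc N (partner N v) = none := by
  rcases v with _ | ⟨m, S⟩
  · rfl
  · by_cases h : m ≤ N <;> simp [partner, trunc, h]

theorem trunc_replaceFar (N : ℕ) {w : Vert n} (hw : trunc N w = none) (v : Vert n) :
    trunc N (replaceFar N w v) = trunc N v := by
  rcases v with _ | ⟨m, S⟩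
  · exact hw
  · by_cases h : m ≤ N
    · simp [replaceFar, h]
    · simp only [replaceFar, h, if_false, hw]
      simp [trunc, h]

theorem replaceFar_default (N : ℕ) (w : Vert n) :
    replaceFar N w (defaultLabel n).2 = (defaultLabel n).2 := by
  simp [replaceFar, defaultLabel]

theorem compl_ne (hn : n ≠ 0) (S : Finset (Fin n)) : S ≠ Sᶜ := by
  have : NeZero n := ⟨hn⟩
  intro h
  by_cases h0 : (0 : Fin n) ∈ S
  · have := h0; rw [h, Finset.mem_compl] at this; exact this h0
  · have := Finset.mem_compl.2 h0; rw [← h] at this; exact h0 this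

/-- If `u` and `v` are adjacent, then so are a vertex `b` that is equal to `u` up to truncation and
the vertex obtained from `v` by a replacement with the partner of `b`. -/
theorem adj_replaceFar (hn : n ≠ 0) (N : ℕ) {u v b : Vert n} (h : Adj u v)
    (hb : trunc N u = trunc N b) : Adj b (replaceFar N (partner N b) v) := by
  rcases u with _ | ⟨m, S⟩ <;> rcases v with _ | ⟨m', S'⟩ <;> try exact h.elim
  · rcases b with _ | ⟨k, T⟩
    · trivial
    · have : ¬ k ≤ N := by
        intro hk; simp [trunc, hk] at hb
      simpa [replaceFar, partner, this, Adj] using compl_ne hn T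
  · obtain ⟨rfl, hS⟩ := h
    rcases b with _ | ⟨k, T⟩
    · have : ¬ m ≤ N := by
        intro hk; simp [trunc, hk] at hb
      simp [replaceFar, partner, this, Adj]
    · by_cases hm : m ≤ N <;> by_cases hk : k ≤ N <;> simp [trunc, hm, hk] at hb
      · obtain ⟨rfl, rfl⟩ := hb
        simpa [replaceFar, hm, Adj] using hS
      · simpa [replaceFar, partner, hm, hk, Adj] using compl_ne hn T

theorem adj_partner (hn : n ≠ 0) (N : ℕ) (b : Vert n) :
    Adj (partner N b) (partner N b) ∨ Adj b (partner N b) := by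
  rcases b with _ | ⟨k, T⟩
  · exact Or.inl trivial
  · by_cases hk : k ≤ N
    · left; simp [partner, hk, Adj]
    · right; simpa [partner, hk, Adj] using compl_ne hn T

theorem adj_replaceFar_replaceFar (N : ℕ) {u v : Vert n} (h : Adj u v) (w : Vert n) :
    Adj (replaceFar N w u) (replaceFar N w v) ∨
      (replaceFar N w u = w ∧ replaceFar N w v = w) := by
  rcases u with _ | ⟨m, S⟩ <;> rcases v with _ | ⟨m', S'⟩ <;> try exact h.elim
  · exact Or.inr ⟨rfl, rfl⟩
  · obtain ⟨rfl, hS⟩ := h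
    by_cases hm : m ≤ N
    · left; simpa [replaceFar, hm, Adj] using hS
    · right; simp [replaceFar, hm]

theorem adj_symm {u v : Vert n} (h : Adj u v) : Adj v u := by
  rcases u with _ | ⟨m, S⟩ <;> rcases v with _ | ⟨m', S'⟩ <;> try exact h.elim
  · trivial
  · exact ⟨h.1.symm, h.2.symm⟩

open Classical in
/-- Let `b` agree with `a` off `i`, and let its entry `i` be different from all others. If `a'` is
close to `a`, then the labels in `b` of sets that involve `i` can be adapted to `a'`: their vertices
far away are moved next to the vertex of the facet of `a'` opposite to `i`, which is the only one
that they may have to be adjacent to. -/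
noncomputable def adapt (hn : n ≠ 0) (N : ℕ) (i : Fin n) (a a' b : Pattern.{u} n)
    (h : Close N a a') (hs : Sim i b a) (hi : ∀ j, j ≠ i → ¬ b.r i j) : Pattern.{u} n where
  r := b.r
  K S := if i ∈ S then
      ((b.K S).1, replaceFar N (partner N (a'.K {i}ᶜ).2) (b.K S).2)
    else a'.K S
  equiv := b.equiv
  inv S T h1 h2 := by
    have hST : ∀ S T : Finset (Fin n), (∀ s ∈ S, ∃ t ∈ T, b.r s t) → i ∈ S → i ∈ T :=
      fun S T h hS => by
        obtain ⟨t, ht, hit⟩ := h i hS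
        by_contra hiT
        exact hi t (fun h => hiT (h ▸ ht)) hit
    by_cases hS : i ∈ S
    · have hT := hST S T h1 hS
      simp only [hS, hT, if_true, b.inv S T h1 h2]
    · have hT : i ∉ T := fun hT => hS (hST T S h2 hT)
      simp only [hS, hT, if_false]
      have hr : ∀ s t, s ≠ i → t ≠ i → b.r s t → a'.r s t := fun s t hs' ht' hst => by
        rw [← h.1]; exact (hs.1 s t hs' ht').1 hst
      apply a'.inv
      · intro s hs'
        obtain ⟨t, ht, hst⟩ := h1 s hs'
        exact ⟨t, ht, hr s t (fun h => hS (h ▸ hs')) (fun h => hT (h ▸ ht)) hst⟩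
      · intro t ht
        obtain ⟨s, hs', hst⟩ := h2 t ht
        exact ⟨s, hs', hr t s (fun h => hT (h ▸ ht)) (fun h => hS (h ▸ hs')) hst⟩
  sub S hS := by
    by_cases hiS : i ∈ S
    · simp only [hiS, if_true, b.sub S hS, replaceFar_default]
    · simp only [hiS, if_false]
      apply a'.sub
      intro s hs' t ht
      rw [← h.1]
      exact (hs.1 s t (fun h => hiS (h ▸ hs')) (fun h => hiS (h ▸ ht))).1 (hS s hs' t ht)
  con hr c hc := by
    have hmem : ∀ j, j ≠ i → i ∈ ({j}ᶜ : Finset (Fin n)) := fun j hj => by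
      simpa using hj.symm
    have hnm : i ∉ ({i}ᶜ : Finset (Fin n)) := by simp
    have key : ∀ j, (b.K {j}ᶜ).1 = c := by
      intro j
      rw [← hc j]
      by_cases hj : j = i
      · subst hj
        simp only [hnm, if_false]
        rw [hs.2 _ hnm, (h.2 _).1]
      · simp only [hmem j hj, if_true]
    have htr : trunc N (b.K {i}ᶜ).2 = trunc N (a'.K {i}ᶜ).2 := by
      rw [hs.2 _ hnm, (h.2 _).2]
    obtain ⟨j, k, hjk, hadj⟩ := b.con hr c key
    by_cases hj : j = i
    · subst hj
      refine ⟨j, k, hjk, ?_⟩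
      simp only [hnm, hmem k hjk.symm, if_true, if_false]
      exact adj_replaceFar hn N hadj htr
    · by_cases hk : k = i
      · subst hk
        refine ⟨k, j, hjk.symm, ?_⟩
        simp only [hnm, hmem j hjk, if_true, if_false]
        exact adj_replaceFar hn N (adj_symm hadj) htr
      · rcases adj_replaceFar_replaceFar N hadj (partner N (a'.K {i}ᶜ).2) with h' | ⟨hw, hw'⟩
        · refine ⟨j, k, hjk, ?_⟩
          simp only [hmem j hj, hmem k hk, if_true]
          exact h'
        · rcases adj_partner hn N (a'.K {i}ᶜ).2 with h' | h'
          · refine ⟨j, k, hjk, ?_⟩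
            simp only [hmem j hj, hmem k hk, if_true]
            rwa [hw, hw']
          · refine ⟨i, j, Ne.symm hj, ?_⟩
            simp only [hnm, hmem j hj, if_true, if_false]
            rwa [hw]

/-- Closeness is compatible with agreement off `i`. -/
theorem Close.exists_sim (hn : n ≠ 0) {N : ℕ} {i : Fin n} {a a' b : Pattern.{u} n}
    (h : Close N a a') (hs : Sim i b a) : ∃ b', Sim i b' a' ∧ Close N b b' := by
  by_cases hi : ∃ j, j ≠ i ∧ b.r i j
  · obtain ⟨j, hj, hij⟩ := hi
    refine ⟨Pattern.act (repl i j) a', sim_act_repl i j a', ?_⟩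
    rw [eq_act_repl hj hs hij]
    exact h.act _
  · push Not at hi
    refine ⟨adapt hn N i a a' b h hs hi, ⟨?_, ?_⟩, ⟨rfl, ?_⟩⟩
    · intro j k hj hk
      rw [← h.1]
      exact hs.1 j k hj hk
    · intro S hS
      simp only [adapt, hS, if_false]
    · intro S
      by_cases hS : i ∈ S
      · simp only [adapt, hS, if_true, true_and]
        rw [trunc_replaceFar N (trunc_partner N _)]
      · simp only [adapt, hS, if_false]
        rw [hs.2 S hS]
        exact h.2 S

/-- A code for patterns up to closeness. -/
def code (N : ℕ) (a : Pattern.{u} n) : (Fin n → Fin n → Prop) ×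
    (Finset (Fin n) → Col n × Option (Fin (N + 1) × Finset (Fin n))) :=
  (a.r, fun S => ((a.K S).1, (trunc N (a.K S).2).map fun v => (Fin.ofNat (N + 1) v.1, v.2)))

theorem trunc_eq_of_map_eq {N : ℕ} {u v : Vert n}
    (h : (trunc N u).map (fun v => (Fin.ofNat (N + 1) v.1, v.2)) =
      (trunc N v).map fun v => (Fin.ofNat (N + 1) v.1, v.2)) : trunc N u = trunc N v := by
  have key : ∀ (u : Vert n) m S, trunc N u = some (m, S) → m ≤ N := by
    rintro (_ | ⟨k, T⟩) m S hu
    · simp [trunc] at hu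
    · by_cases hk : k ≤ N
      · simp only [trunc, hk, if_true, Option.some.injEq, Prod.mk.injEq] at hu
        omega
      · simp [trunc, hk] at hu
  rcases hu : trunc N u with _ | ⟨k, S⟩ <;> rcases hv : trunc N v with _ | ⟨l, T⟩ <;>
    rw [hu, hv] at h <;> simp at h ⊢
  have h1 := key _ _ _ hu
  have h2 := key _ _ _ hv
  refine ⟨?_, h.2⟩
  have := congrArg Fin.val h.1
  simpa [Nat.mod_eq_of_lt (Nat.lt_succ_of_le h1), Nat.mod_eq_of_lt (Nat.lt_succ_of_le h2)]
    using this

theorem close_of_code_eq {N : ℕ} {a b : Pattern.{u} n} (h : code N a = code N b) :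
    Close N a b := by
  refine ⟨congrArg Prod.fst h, fun S => ?_⟩
  have := congrFun (congrArg Prod.snd h) S
  simp only [code, Prod.mk.injEq] at this
  exact ⟨this.1, trunc_eq_of_map_eq this.2⟩

instance : Countable (Pattern.{u} n) := by
  have : Function.Injective fun a : Pattern.{u} n => (a.r, a.K) := fun a b h =>
    Pattern.ext (congrArg Prod.fst h) (congrArg Prod.snd h)
  exact this.countable

end Pattern

/-! ### The algebra and its completion -/

open Pattern

/-- The sets of patterns that do not depend on vertices outside of finitely many cliques. -/
def approxSets (n : ℕ) : BooleanSubalgebra (Set (Pattern.{u} n)) where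
  carrier := {X | ∃ N, ∀ a b, Close N a b → a ∈ X → b ∈ X}
  supClosed' := by
    rintro X ⟨N, hN⟩ Y ⟨M, hM⟩
    refine ⟨max N M, fun a b h hab => ?_⟩
    rcases hab with h' | h'
    · exact Or.inl (hN a b (h.mono (le_max_left _ _)) h')
    · exact Or.inr (hM a b (h.mono (le_max_right _ _)) h')
  infClosed' := by
    rintro X ⟨N, hN⟩ Y ⟨M, hM⟩
    exact ⟨max N M, fun a b h hab => ⟨hN a b (h.mono (le_max_left _ _)) hab.1,
      hM a b (h.mono (le_max_right _ _)) hab.2⟩⟩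
  compl_mem' := by
    rintro X ⟨N, hN⟩
    exact ⟨N, fun a b h ha hb => ha (hN b a h.symm hb)⟩
  bot_mem' := ⟨0, fun _ _ _ h => h⟩

theorem mem_approxSets {n : ℕ} {X : Set (Pattern.{u} n)} :
    X ∈ approxSets n ↔ ∃ N, ∀ a b, Close N a b → a ∈ X → b ∈ X := Iff.rfl

theorem frameOp_mem_approxSets {n : ℕ} (hn : n ≠ 0) (f : PolyOp n) {X : Set (Pattern.{u} n)}
    (hX : X ∈ approxSets n) : frameOp Sim act f X ∈ approxSets n := by
  obtain ⟨N, hN⟩ := mem_approxSets.1 hX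
  rw [mem_approxSets]
  refine ⟨N, fun a a' h ha => ?_⟩
  cases f with
  | c i =>
    obtain ⟨b, hb, hba⟩ := ha
    obtain ⟨b', hb', hc⟩ := h.exists_sim hn hba
    exact ⟨b', hN _ _ hc hb, hb'⟩
  | s i j => exact hN _ _ (h.act _) ha
  | p i j => exact hN _ _ (h.act _) ha

theorem diag_mem_approxSets {n : ℕ} (i j : Fin n) :
    {a : Pattern.{u} n | a.r i j} ∈ approxSets n :=
  mem_approxSets.2 ⟨0, fun a b h (ha : a.r i j) => show b.r i j by rwa [← h.1]⟩

theorem singleton_mem_approxSets {n : ℕ} {a : Pattern.{u} n} (ha : a.Real) :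
    {a} ∈ approxSets n := by
  obtain ⟨N, hN⟩ := ha.exists_close_imp_eq
  exact mem_approxSets.2 ⟨N, fun b c h hb => by
    obtain rfl : b = a := hb
    exact (hN c h).symm⟩

theorem exists_real_mem {n : ℕ} {X : Set (Pattern.{u} n)} (hX : X ∈ approxSets n)
    {a : Pattern.{u} n} (ha : a ∈ X) : ∃ b ∈ X, b.Real := by
  obtain ⟨N, hN⟩ := mem_approxSets.1 hX
  exact ⟨fill (N + 1) a, hN _ _ (close_fill (Nat.lt_succ_self N) a) ha, fill_real _ a⟩

instance (n : ℕ) : Countable (approxSets.{u} n) := by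
  let F : (Σ N : ℕ, Set ((Fin n → Fin n → Prop) ×
      (Finset (Fin n) → Col n × Option (Fin (N + 1) × Finset (Fin n))))) → Set (Pattern.{u} n) :=
    fun p => code p.1 ⁻¹' p.2
  have hsub : ((approxSets.{u} n : Set (Set (Pattern.{u} n)))) ⊆ Set.range F := by
    intro X hX
    obtain ⟨N, hN⟩ := mem_approxSets.1 hX
    refine ⟨⟨N, code N '' X⟩, ?_⟩
    ext a
    constructor
    · rintro ⟨b, hb, hba⟩
      exact hN b a (close_of_code_eq hba) hb
    · intro ha
      exact ⟨a, ha, rfl⟩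
  exact ((Set.countable_range F).mono hsub).to_subtype

/-- The algebra of the sets of patterns that do not depend on vertices outside of finitely many
cliques. -/
def approxAlg (n : ℕ) (hn : n ≠ 0) : Alg.{u} (sigPEA n) where
  carrier := approxSets n
  op f X := ⟨frameOp Sim act f X, frameOp_mem_approxSets hn f X.2⟩
  const := fun | .d i j => ⟨{a | a.r i j}, diag_mem_approxSets i j⟩

/-- The real patterns, as a type. -/
abbrev RealPattern (n : ℕ) : Type u := {a : Pattern.{u} n // a.Real}

/-- The complex algebra of the real patterns. -/
def realAlg (n : ℕ) : Alg.{u} (sigPEA n) where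
  carrier := Set (RealPattern.{u} n)
  op f X := frameOp (fun i (a b : RealPattern.{u} n) => Sim i a.1 b.1)
    (fun f a => ⟨act f a.1, a.2.act f⟩) f X
  const := fun | .d i j => {a | a.1.r i j}

/-- Restriction to the real patterns. It commutes with the cylindrifications as limit points can be
replaced by vertices far away. -/
def restrictReal (n : ℕ) (hn : n ≠ 0) : Alg.Hom (approxAlg.{u} n hn) (realAlg n) where
  toFun X := {a | a.1 ∈ X.1}
  map_sup' _ _ := rfl
  map_inf' _ _ := rfl
  map_top' := rfl
  map_bot' := rfl
  map_op f X := by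
    cases f with
    | c i =>
      refine Set.ext (α := RealPattern.{u} n) fun a => ?_
      constructor
      · rintro ⟨b, hb, hba⟩
        obtain ⟨N, hN⟩ := mem_approxSets.1 X.2
        exact ⟨⟨fill (N + 1) b, fill_real _ b⟩, hN _ _ (close_fill (Nat.lt_succ_self N) b) hb,
          hba.fill a.2 _⟩
      · rintro ⟨b, hb, hba⟩
        exact ⟨b.1, hb, hba⟩
    | s i j => rfl
    | p i j => rfl
  map_const := fun | .d i j => rfl

theorem realAlg_isCompletion (n : ℕ) (hn : n ≠ 0) :
    Alg.IsCompletion (approxAlg.{u} n hn) (realAlg n) := by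
  refine ⟨fun X => ⟨sSup (α := Set (RealPattern.{u} n)) X, isLUB_sSup (α := Set _) X⟩,
    fun f X x h => frameOp_isLUB (X := RealPattern.{u} n) (fun i a b => Sim i a.1 b.1)
      (fun f a => ⟨act f a.1, a.2.act f⟩) f X x h, restrictReal n hn, ?_, ?_⟩
  · have key : ∀ X Y : approxSets.{u} n,
        (∀ a : RealPattern.{u} n, a.1 ∈ X.1 ↔ a.1 ∈ Y.1) → X.1 ⊆ Y.1 := by
      intro X Y h a ha
      by_contra hna
      obtain ⟨b, hb, hbr⟩ := exists_real_mem (approxSets n |>.infClosed X.2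
        (BooleanSubalgebra.compl_mem Y.2)) ⟨ha, hna⟩
      exact hb.2 ((h ⟨b, hbr⟩).1 hb.1)
    intro X Y hXY
    have h : ∀ a : RealPattern.{u} n, a.1 ∈ X.1 ↔ a.1 ∈ Y.1 := fun a =>
      Set.ext_iff.1 (show ({a | a.1 ∈ X.1} : Set (RealPattern.{u} n)) = {a | a.1 ∈ Y.1} from hXY) a
    exact Subtype.ext ((key X Y h).antisymm (key Y X fun a => (h a).symm))
  · intro c hc
    obtain ⟨a, ha⟩ := Set.nonempty_iff_ne_empty (s := (c : Set (RealPattern.{u} n))).2 hc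
    refine ⟨⟨{a.1}, singleton_mem_approxSets a.2⟩, ?_, ?_⟩
    · intro h
      have : ({a.1} : Set (Pattern.{u} n)) = ∅ := congrArg Subtype.val h
      exact Set.singleton_ne_empty _ this
    · intro b hb
      obtain rfl : b = a := Subtype.ext hb
      exact ha

theorem approxAlg_isAtomic (n : ℕ) (hn : n ≠ 0) : IsAtomic (approxAlg.{u} n hn) := by
  refine ⟨fun X => ?_⟩
  rcases Set.eq_empty_or_nonempty X.1 with h | ⟨a, ha⟩
  · exact Or.inl (Subtype.ext h)
  · obtain ⟨b, hb, hbr⟩ := exists_real_mem X.2 ha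
    refine Or.inr ⟨⟨{b}, singleton_mem_approxSets hbr⟩, ⟨?_, ?_⟩, ?_⟩
    · intro h
      have : ({b} : Set (Pattern.{u} n)) = ∅ := congrArg Subtype.val h
      exact Set.singleton_ne_empty _ this
    · intro Y hY
      have hlt : Y.1 < ({b} : Set (Pattern.{u} n)) := hY
      exact Subtype.ext (Set.ssubset_singleton_iff.1 hlt)
    · intro c hc
      obtain rfl : c = b := hc
      exact hb

/-! ### A structure that realizes all patterns generically -/

section GenericStructure

variable {n : ℕ}

/-- The pattern of constant tuples. -/
def Pattern.const (hn : 2 ≤ n) : Pattern.{u} n where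
  r _ _ := True
  K _ := defaultLabel n
  equiv := ⟨fun _ => trivial, fun _ => trivial, fun _ _ => trivial⟩
  inv _ _ _ _ := rfl
  sub _ _ := rfl
  con h := by
    have := h ⟨0, by omega⟩ ⟨1, by omega⟩ trivial
    simp at this

theorem exists_cofinal_enumeration (τ : Type*) [Countable τ] [Nonempty τ] :
    ∃ d : ℕ → τ, ∀ t b, ∃ p, b < p ∧ d p = t := by
  obtain ⟨f, hf⟩ := exists_surjective_nat τ
  refine ⟨fun p => f p.unpair.1, fun t b => ?_⟩
  obtain ⟨k, rfl⟩ := hf t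
  exact ⟨Nat.pair k (b + 1), Nat.lt_of_succ_le (Nat.right_le_pair k (b + 1)), by simp⟩

theorem exists_newCol (a : Pattern.{u} n) : ∃ c : Col n, ∀ S, (a.K S).1 ≠ c := by
  by_contra h
  push Not at h
  have := Fintype.card_le_of_surjective (fun S => (a.K S).1) h
  simp at this

/-- A colour that does not occur in the pattern `a`. -/
noncomputable def newCol (a : Pattern.{u} n) : Col n := (exists_newCol a).choose

theorem newCol_spec (a : Pattern.{u} n) (S : Finset (Fin n)) : (a.K S).1 ≠ newCol a :=
  (exists_newCol a).choose_spec S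

/-- The extension task `d p` assigned to `p` is a tuple `x`, an index `i` and a pattern that `x` is
to receive when its entry `i` is replaced by `p`. A set with largest element `p` is labelled
accordingly if its other elements are entries of `x`. All remaining sets with largest element `p`
get the limit point, in a colour that the pattern does not use. -/
noncomputable def setLabel (d : ℕ → (Fin n → ℕ) × Fin n × Pattern.{u} n) (T : Finset ℕ) :
    Col n × Vert n :=
  if T.card ≤ 1 then defaultLabel n
  else if T.erase (T.sup id) ⊆ ({(d (T.sup id)).2.1}ᶜ : Finset (Fin n)).image (d (T.sup id)).1 then
    (d (T.sup id)).2.2.K (insert (d (T.sup id)).2.1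
      (({(d (T.sup id)).2.1}ᶜ : Finset (Fin n)).filter fun j => (d (T.sup id)).1 j ∈ T))
  else (newCol (d (T.sup id)).2.2, none)

/-- The task assigned to `p` asks for an extension, by a new point, of the tuple `x` to a tuple with
a pattern that agrees with the one of `x` off `i`. -/
structure IsTask (d : ℕ → (Fin n → ℕ) × Fin n × Pattern.{u} n) (p : ℕ) (x : Fin n → ℕ) (i : Fin n)
    (a : Pattern.{u} n) : Prop where
  eq : d p = (x, i, a)
  lt : ∀ j, x j < p
  r_iff : ∀ j k, j ≠ i → k ≠ i → (a.r j k ↔ x j = x k)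
  K_eq : ∀ S, i ∉ S → a.K S = setLabel d (S.image x)
  new : ∀ j, j ≠ i → ¬ a.r i j

/-- The points of the structure: the initial point `0`, and the numbers whose task is about points
of the structure. -/
inductive IsPoint (d : ℕ → (Fin n → ℕ) × Fin n × Pattern.{u} n) : ℕ → Prop
  | zero : IsPoint d 0
  | task (p : ℕ) (x : Fin n → ℕ) (i : Fin n) (a : Pattern.{u} n) (h : IsTask d p x i a)
      (hx : ∀ j, IsPoint d (x j)) : IsPoint d p

variable {d : ℕ → (Fin n → ℕ) × Fin n × Pattern.{u} n}

theorem sup_eq_of_max {T : Finset ℕ} {p : ℕ} (hp : p ∈ T) (h : ∀ q ∈ T, q ≤ p) :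
    T.sup id = p :=
  le_antisymm (Finset.sup_le h) (Finset.le_sup (f := id) hp)

theorem IsTask.setLabel_eq {p : ℕ} {x : Fin n → ℕ} {i : Fin n} {a : Pattern.{u} n}
    (h : IsTask d p x i a) {T : Finset ℕ} (hT : 1 < T.card) (hp : p ∈ T) (hm : ∀ q ∈ T, q ≤ p) :
    setLabel d T = if T.erase p ⊆ ({i}ᶜ : Finset (Fin n)).image x then
      a.K (insert i (({i}ᶜ : Finset (Fin n)).filter fun j => x j ∈ T))
      else (newCol a, none) := by
  rw [setLabel, if_neg (by omega), sup_eq_of_max hp hm, h.eq]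

theorem IsTask.update_eq_iff {p : ℕ} {x : Fin n → ℕ} {i : Fin n} {a : Pattern.{u} n}
    (h : IsTask d p x i a) (j k : Fin n) :
    Function.update x i p j = Function.update x i p k ↔ a.r j k := by
  by_cases hj : j = i
  · by_cases hk : k = i
    · subst hj hk; simp [a.equiv.refl]
    · subst hj
      simp only [Function.update_self, Function.update_of_ne hk, h.new k hk, iff_false]
      exact (h.lt k).ne'
  · by_cases hk : k = i
    · subst hk
      have : ¬ a.r j k := fun hr => h.new j hj (a.equiv.symm hr)
      simp only [Function.update_self, Function.update_of_ne hj, this, iff_false]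
      exact (h.lt j).ne
    · rw [Function.update_of_ne hj, Function.update_of_ne hk, h.r_iff j k hj hk]

/-- A point solves its task. -/
theorem IsTask.setLabel_update {p : ℕ} {x : Fin n → ℕ} {i : Fin n} {a : Pattern.{u} n}
    (h : IsTask d p x i a) (S : Finset (Fin n)) :
    setLabel d (S.image (Function.update x i p)) = a.K S := by
  by_cases hi : i ∈ S
  · by_cases hS : (S.image (Function.update x i p)).card ≤ 1
    · rw [setLabel, if_pos hS, a.sub]
      intro s hs t ht
      rw [← h.update_eq_iff]
      exact Finset.card_le_one.1 hS _ (Finset.mem_image_of_mem _ hs) _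
        (Finset.mem_image_of_mem _ ht)
    · have hp : p ∈ S.image (Function.update x i p) :=
        Finset.mem_image.2 ⟨i, hi, by simp⟩
      have hle : ∀ j, Function.update x i p j ≤ p := fun j => by
        by_cases hj : j = i
        · subst hj; simp
        · rw [Function.update_of_ne hj]; exact (h.lt j).le
      rw [h.setLabel_eq (by omega) hp, if_pos]
      · apply a.inv
        · intro s hs
          by_cases hsi : s = i
          · exact ⟨s, hsi ▸ hi, a.equiv.refl s⟩
          · have := Finset.mem_of_mem_insert_of_ne hs hsi
            obtain ⟨k, hk, hks⟩ := Finset.mem_image.1 (Finset.mem_filter.1 this).2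
            refine ⟨k, hk, ?_⟩
            rw [← h.update_eq_iff, hks, Function.update_of_ne hsi]
        · intro t ht
          refine ⟨t, ?_, a.equiv.refl t⟩
          by_cases hti : t = i
          · exact hti ▸ Finset.mem_insert_self _ _
          · refine Finset.mem_insert_of_mem (Finset.mem_filter.2 ⟨by simpa using hti, ?_⟩)
            exact Finset.mem_image.2 ⟨t, ht, Function.update_of_ne hti _ _⟩
      · intro q hq
        obtain ⟨hqp, hq⟩ := Finset.mem_erase.1 hq
        obtain ⟨k, -, rfl⟩ := Finset.mem_image.1 hq
        have hki : k ≠ i := fun hki => hqp (by rw [hki]; simp)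
        exact Finset.mem_image.2 ⟨k, by simpa using hki, (Function.update_of_ne hki _ _).symm⟩
      · intro q hq
        obtain ⟨k, -, rfl⟩ := Finset.mem_image.1 hq
        exact hle k
  · rw [h.K_eq S hi]
    congr 1
    refine Finset.image_congr fun k hk => ?_
    exact Function.update_of_ne (fun h => hi (by rwa [h] at hk)) _ _

/-- The facets of a set of `n` points satisfy the restriction on labels. If the other points are
entries in the task of the largest point `p`, then this holds by the choice of the task. Otherwise
at most one of the facets that contain `p` is labelled according to the task, and the others have
the new colour and the limit point as their vertex. -/
theorem exists_adj_facets (hn : 3 ≤ n) {x : Fin n → ℕ} (hx : ∀ j, IsPoint d (x j))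
    (hinj : Function.Injective x) (c : Col n)
    (hc : ∀ i, (setLabel d (({i}ᶜ : Finset (Fin n)).image x)).1 = c) :
    ∃ i j, i ≠ j ∧ Adj (setLabel d (({i}ᶜ : Finset (Fin n)).image x)).2
      (setLabel d (({j}ᶜ : Finset (Fin n)).image x)).2 := by
  obtain ⟨k0, -, hmax⟩ := Finset.exists_max_image (Finset.univ : Finset (Fin n)) x
    ⟨⟨0, by omega⟩, Finset.mem_univ _⟩
  have hcard : ∀ k : Fin n, 1 < ({k}ᶜ : Finset (Fin n)).card := fun k => by
    rw [Finset.card_compl, Finset.card_singleton, Fintype.card_fin]; omega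
  obtain ⟨k1, hk1, k2, hk2, hk12⟩ := Finset.one_lt_card.1 (hcard k0)
  rw [Finset.mem_compl, Finset.mem_singleton] at hk1 hk2
  obtain ⟨y, i, a, ht⟩ : ∃ y i a, IsTask d (x k0) y i a := by
    generalize hp : x k0 = p
    have hpt := hx k0
    rw [hp] at hpt
    cases hpt with
    | zero =>
      exact (hk1 (hinj (by have := hmax k1 (Finset.mem_univ _); omega))).elim
    | task _ y i a h _ => exact ⟨y, i, a, h⟩
  by_cases hT : ∀ k, k ≠ k0 → ∃ j, j ≠ i ∧ y j = x k
  · have hτ : ∀ k, ∃ j, Function.update y i (x k0) j = x k := fun k => by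
      by_cases hk : k = k0
      · exact ⟨i, by rw [hk]; simp⟩
      · obtain ⟨j, hj, hjk⟩ := hT k hk
        exact ⟨j, by rw [Function.update_of_ne hj, hjk]⟩
    choose τ hτ using hτ
    have hK : ∀ S : Finset (Fin n), setLabel d (S.image x) = (act τ a).K S := fun S => by
      have : S.image x = (S.image τ).image (Function.update y i (x k0)) := by
        rw [Finset.image_image]
        exact Finset.image_congr fun k _ => (hτ k).symm
      rw [this, ht.setLabel_update]
      rfl
    simp only [hK] at hc ⊢
    refine (act τ a).con (fun j k hjk => hinj ?_) c hc
    rw [← hτ j, ← hτ k]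
    exact (ht.update_eq_iff _ _).2 hjk
  · have hfacet : ∀ k, k ≠ k0 → ((∀ l, l ≠ k → l ≠ k0 → ∃ j, j ≠ i ∧ y j = x l) ∧
        c ≠ newCol a) ∨ setLabel d (({k}ᶜ : Finset (Fin n)).image x) = (newCol a, none) := by
      intro k hk
      have hlab := ht.setLabel_eq (T := ({k}ᶜ : Finset (Fin n)).image x)
        (by rw [Finset.card_image_of_injective _ hinj]; exact hcard k)
        (Finset.mem_image_of_mem _ (by simpa using Ne.symm hk))
        (fun q hq => by
          obtain ⟨l, -, rfl⟩ := Finset.mem_image.1 hq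
          exact hmax l (Finset.mem_univ l))
      split_ifs at hlab with hsub
      · left
        constructor
        · intro l hl hl0
          obtain ⟨j, hj, hjl⟩ := Finset.mem_image.1 (hsub (Finset.mem_erase.2
            ⟨fun h => hl0 (hinj h), Finset.mem_image_of_mem x (a := l) (by simpa using hl)⟩))
          exact ⟨j, by simpa using hj, hjl⟩
        · rw [← hc k, hlab]
          exact newCol_spec a _
      · exact Or.inr hlab
    have hnew : ∀ k, setLabel d (({k}ᶜ : Finset (Fin n)).image x) = (newCol a, none) →
        c = newCol a := fun k hk => by rw [← hc k, hk]
    refine ⟨k1, k2, hk12, ?_⟩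
    rcases hfacet k1 hk1 with ⟨h1, hne⟩ | h1 <;> rcases hfacet k2 hk2 with ⟨h2, hne'⟩ | h2
    · refine (hT fun k hk => ?_).elim
      by_cases hkk : k = k1
      · exact h2 k (by rw [hkk]; exact hk12) hk
      · exact h1 k hkk hk
    · exact (hne (hnew k2 h2)).elim
    · exact (hne' (hnew k1 h1)).elim
    · rw [h1, h2]
      trivial

/-- The pattern of a tuple of points. -/
noncomputable def typeOf (d : ℕ → (Fin n → ℕ) × Fin n × Pattern.{u} n) (hn : 3 ≤ n)
    (x : Fin n → ULift.{u} {p // IsPoint d p}) : Pattern.{u} n where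
  r i j := x i = x j
  K S := setLabel d (S.image fun k => (x k).down.1)
  equiv := ⟨fun _ => rfl, Eq.symm, Eq.trans⟩
  inv S T h1 h2 := by
    congr 1
    ext p
    simp only [Finset.mem_image]
    constructor
    · rintro ⟨s, hs, rfl⟩
      obtain ⟨t, ht, hst⟩ := h1 s hs
      exact ⟨t, ht, by rw [hst]⟩
    · rintro ⟨s, hs, rfl⟩
      obtain ⟨t, ht, hst⟩ := h2 s hs
      exact ⟨t, ht, by rw [hst]⟩
  sub S h := by
    rw [setLabel, if_pos]
    rw [Finset.card_le_one]
    intro p hp q hq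
    obtain ⟨s, hs, rfl⟩ := Finset.mem_image.1 hp
    obtain ⟨t, ht, rfl⟩ := Finset.mem_image.1 hq
    rw [h s hs t ht]
  con h := exists_adj_facets hn (fun j => (x j).down.2)
    fun i j hij => h i j (ULift.down_injective (Subtype.ext hij))

theorem typeOf_comp (hn : 3 ≤ n) (x : Fin n → ULift.{u} {p // IsPoint d p}) (f : Fin n → Fin n) :
    typeOf d hn (x ∘ f) = act f (typeOf d hn x) := by
  ext1
  · rfl
  · funext S
    simp only [typeOf, act, Finset.image_image]
    rfl

theorem typeOf_sim (hn : 3 ≤ n) {x y : Fin n → ULift.{u} {p // IsPoint d p}} {i : Fin n}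
    (h : ∀ k, k ≠ i → y k = x k) : Sim i (typeOf d hn y) (typeOf d hn x) := by
  constructor
  · intro j k hj hk
    simp only [typeOf, h j hj, h k hk]
  · intro S hS
    simp only [typeOf]
    congr 1
    refine Finset.image_congr fun k hk => ?_
    simp only [h k fun he => hS (by rwa [he] at hk)]

/-- Every pattern that agrees off `i` with the one of a tuple is realized by a modification of the
tuple at `i`. -/
theorem exists_typeOf_eq (hd : ∀ t b, ∃ p, b < p ∧ d p = t) (hn : 3 ≤ n)
    (x : Fin n → ULift.{u} {p // IsPoint d p}) {i : Fin n} {a : Pattern.{u} n}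
    (h : Sim i a (typeOf d hn x)) :
    ∃ y : Fin n → ULift.{u} {p // IsPoint d p}, (∀ k, k ≠ i → y k = x k) ∧
      typeOf d hn y = a := by
  by_cases hi : ∃ j, j ≠ i ∧ a.r i j
  · obtain ⟨j, hj, hij⟩ := hi
    refine ⟨x ∘ repl i j, fun k hk => ?_, ?_⟩
    · simp [Function.update_of_ne hk]
    · rw [typeOf_comp, ← eq_act_repl hj h hij]
  · push Not at hi
    let x' : Fin n → ℕ := fun k => (x k).down.1
    obtain ⟨p, hp, hdp⟩ := hd (x', i, a) (Finset.univ.sup x')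
    have ht : IsTask d p x' i a :=
      ⟨hdp, fun j => lt_of_le_of_lt (Finset.le_sup (Finset.mem_univ j)) hp,
        fun j k hj hk => (h.1 j k hj hk).trans
          ⟨fun (e : x j = x k) => by simp only [x', e],
            fun e => ULift.down_injective (Subtype.ext e)⟩,
        fun S hS => h.2 S hS, hi⟩
    let q : ULift.{u} {p // IsPoint d p} := ⟨⟨p, .task p x' i a ht fun j => (x j).down.2⟩⟩
    have hq : (fun k => (Function.update x i q k).down.1) = Function.update x' i p := by
      funext k
      by_cases hk : k = i
      · subst hk; simp [q]
      · simp [Function.update_of_ne hk, x']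
    refine ⟨Function.update x i q, fun k hk => Function.update_of_ne hk _ _, ?_⟩
    ext1
    · funext j k
      rw [eq_iff_iff, ← ht.update_eq_iff, ← hq]
      exact ⟨fun (e : Function.update x i q j = Function.update x i q k) => by simp only [e],
        fun e => ULift.down_injective (Subtype.ext e)⟩
    · funext S
      rw [← ht.setLabel_update, ← hq]
      rfl

/-- All patterns are realized: a constant tuple can be modified entry by entry. -/
theorem typeOf_surjective (hd : ∀ t b, ∃ p, b < p ∧ d p = t) (hn : 3 ≤ n) (a : Pattern.{u} n) :
    ∃ x, typeOf d hn x = a := by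
  have key : ∀ m : ℕ, ∃ x, typeOf d hn x =
      act (fun k : Fin n => if (k : ℕ) ≤ m then k else ⟨0, by omega⟩) a := by
    intro m
    induction m with
    | zero =>
      refine ⟨fun _ => ⟨⟨0, .zero⟩⟩, ?_⟩
      have h0 : ∀ k : Fin n, (if (k : ℕ) ≤ 0 then k else ⟨0, by omega⟩) =
          (⟨0, by omega⟩ : Fin n) := fun k => by
        split_ifs with h
        · exact Fin.ext (Nat.le_zero.1 h)
        · rfl
      simp only [h0]
      ext1
      · funext j k
        simp only [typeOf, act, eq_iff_iff, true_iff]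
        exact a.equiv.refl _
      · funext S
        rw [(typeOf d hn fun _ => ⟨⟨0, .zero⟩⟩).sub S fun _ _ _ _ => rfl, Pattern.sub]
        exact fun _ _ _ _ => a.equiv.refl _
    | succ m ih =>
      obtain ⟨x, hx⟩ := ih
      by_cases hm : m + 1 < n
      · have hne : ∀ k : Fin n, k ≠ ⟨m + 1, hm⟩ → ((k : ℕ) ≤ m + 1 ↔ (k : ℕ) ≤ m) :=
          fun k hk => by
            have : (k : ℕ) ≠ m + 1 := fun h => hk (Fin.ext h)
            omega
        have hs : Sim ⟨m + 1, hm⟩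
            (act (fun k : Fin n => if (k : ℕ) ≤ m + 1 then k else ⟨0, by omega⟩) a)
            (typeOf d hn x) := by
          rw [hx]
          constructor
          · intro j k hj hk
            simp only [act, hne j hj, hne k hk]
          · intro S hS
            simp only [act]
            congr 1
            refine Finset.image_congr fun k hk => ?_
            simp only [hne k fun he => hS (by rwa [he] at hk)]
        obtain ⟨y, -, hy⟩ := exists_typeOf_eq hd hn x hs
        exact ⟨y, hy⟩
      · refine ⟨x, hx.trans ?_⟩
        congr 1
        funext k
        have := k.2
        rw [if_pos (by omega), if_pos (by omega)]
  obtain ⟨x, hx⟩ := key n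
  refine ⟨x, hx.trans ?_⟩
  have : (fun k : Fin n => if (k : ℕ) ≤ n then k else ⟨0, by omega⟩) = id := by
    funext k
    exact if_pos k.2.le
  rw [this, act_id]

/-- The representation of the algebra of approximable sets on the generic structure. -/
noncomputable def approxRep (hd : ∀ t b, ∃ p, b < p ∧ d p = t) (hn : 3 ≤ n) (h0 : n ≠ 0) :
    Alg.Hom (approxAlg.{u} n h0) (fullPEA n (ULift.{u} {p // IsPoint d p})) where
  toFun X := {x | typeOf d hn x ∈ X.1}
  map_sup' _ _ := rfl
  map_inf' _ _ := rfl
  map_top' := rfl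
  map_bot' := rfl
  map_op f X := by
    cases f with
    | c i =>
      refine Set.ext (α := Fin n → ULift.{u} {p // IsPoint d p}) fun x => ?_
      constructor
      · rintro ⟨b, hb, hbx⟩
        obtain ⟨y, hy, rfl⟩ := exists_typeOf_eq hd hn x hbx
        exact ⟨y, hb, hy⟩
      · rintro ⟨y, hy, hyx⟩
        exact ⟨_, hy, typeOf_sim hn hyx⟩
    | s i j =>
      refine Set.ext (α := Fin n → ULift.{u} {p // IsPoint d p}) fun x => ?_
      change act (Function.update id i j) (typeOf d hn x) ∈ X.1 ↔
        typeOf d hn (Function.update x i (x j)) ∈ X.1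
      rw [← typeOf_comp, Function.comp_update, Function.comp_id]
    | p i j =>
      refine Set.ext (α := Fin n → ULift.{u} {p // IsPoint d p}) fun x => ?_
      change act (Equiv.swap i j) (typeOf d hn x) ∈ X.1 ↔
        x ∈ (fun x : Fin n → ULift.{u} {p // IsPoint d p} => x ∘ Equiv.swap i j) ''
          {x | typeOf d hn x ∈ X.1}
      rw [← typeOf_comp]
      constructor
      · intro h
        refine ⟨_, h, ?_⟩
        funext k
        simp
      · rintro ⟨y, hy, rfl⟩
        have : (y ∘ Equiv.swap i j) ∘ Equiv.swap i j = y := by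
          funext k
          simp
        change typeOf d hn ((y ∘ Equiv.swap i j) ∘ Equiv.swap i j) ∈ X.1
        rw [this]
        exact hy
  map_const := fun | .d i j => rfl

/-- A subalgebra of a member of a class of algebras is a subdirect product, with one factor, of
subalgebras of members of the class. -/
theorem Alg.mem_subdirectProductsOf {S : Sig} {K : Set (Alg.{u} S)} {A B : Alg.{u} S} (hB : B ∈ K)
    (e : Alg.Hom A B) (he : Function.Injective e) :
    A ∈ Alg.SubdirectProductsOf (Alg.SubalgebrasOf K) :=
  ⟨PUnit, fun _ => A, fun _ =>
    { toFun := id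
      map_sup' := fun _ _ => rfl
      map_inf' := fun _ _ => rfl
      map_top' := rfl
      map_bot' := rfl
      map_op := fun _ _ => rfl
      map_const := fun _ => rfl }, fun _ => ⟨B, hB, e, he⟩, fun _ => Function.surjective_id,
    fun _ _ h => h PUnit.unit⟩

theorem exists_approxAlg_embedding (hn : 3 ≤ n) (h0 : n ≠ 0) :
    ∃ (U : Type u) (e : Alg.Hom (approxAlg.{u} n h0) (fullPEA n U)), Function.Injective e := by
  have : Nonempty (Pattern.{u} n) := ⟨Pattern.const (by omega)⟩
  have : Nonempty (Fin n) := ⟨⟨0, by omega⟩⟩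
  obtain ⟨d, hd⟩ := exists_cofinal_enumeration ((Fin n → ℕ) × Fin n × Pattern.{u} n)
  refine ⟨_, approxRep hd hn h0, fun X Y h => Subtype.ext (Set.ext fun a => ?_)⟩
  obtain ⟨x, rfl⟩ := typeOf_surjective hd hn a
  exact Set.ext_iff.1 (show ({x | typeOf d hn x ∈ X.1} : Set (Fin n → _)) =
    {x | typeOf d hn x ∈ Y.1} from h) x

end GenericStructure

/-! ### The diagonal-free reduct of the completion is not representable -/

section NotRepresentable

variable {m : ℕ}

theorem zero_ne_two_fin (m : ℕ) : (0 : Fin (m + 3)) ≠ 2 := fun h => by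
  have := congrArg Fin.val h
  simp at this
  rw [Nat.mod_eq_of_lt (by omega)] at this
  omega

theorem one_ne_two_fin (m : ℕ) : (1 : Fin (m + 3)) ≠ 2 := fun h => by
  have := congrArg Fin.val h
  simp at this
  rw [Nat.mod_eq_of_lt (by omega)] at this
  omega

/-- Replace the entry `1` of a tuple by a new one whose set with the entry `0` has the
label `(none, (v + 1, ∅))`. The other sets of several entries that include the new one get labels in
another colour, with distinct vertices of the clique `0`. -/
noncomputable def Pattern.extend (v : ℕ) (a : Pattern.{u} (m + 3)) : Pattern.{u} (m + 3) :=
  let r : Fin (m + 3) → Fin (m + 3) → Prop := fun j k => j = k ∨ (j ≠ 1 ∧ k ≠ 1 ∧ a.r j k)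
  have hr : Equivalence r := by
    refine ⟨fun _ => Or.inl rfl, ?_, ?_⟩
    · rintro j k (rfl | ⟨hj, hk, h⟩)
      · exact Or.inl rfl
      · exact Or.inr ⟨hk, hj, a.equiv.symm h⟩
    · rintro j k l (rfl | ⟨hj, hk, h⟩) (rfl | ⟨hk', hl, h'⟩)
      · exact Or.inl rfl
      · exact Or.inr ⟨hk', hl, h'⟩
      · exact Or.inr ⟨hj, hk, h⟩
      · exact Or.inr ⟨hj, hl, a.equiv.trans h h'⟩
  { r := r
    K := fun S => open Classical in
      if 1 ∈ S then
        if ∀ s ∈ S, s = 1 then defaultLabel _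
        else if ∀ s ∈ S, s ≠ 1 → a.r 0 s then (none, some (v + 1, ∅))
        else (some ∅, some (0, sat r S))
      else a.K S
    equiv := hr
    inv := fun S T h1 h2 => by
      classical
      have key : ∀ S T : Finset (Fin (m + 3)), (∀ s ∈ S, ∃ t ∈ T, r s t) →
          (1 ∈ S → 1 ∈ T) ∧ ((∀ s ∈ T, s = 1) → ∀ s ∈ S, s = 1) ∧
          ((∀ s ∈ T, s ≠ 1 → a.r 0 s) → ∀ s ∈ S, s ≠ 1 → a.r 0 s) := by
        intro S T h
        refine ⟨fun hS => ?_, fun hT s hs => ?_, fun hT s hs hs1 => ?_⟩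
        · obtain ⟨t, ht, rfl | ⟨h, -⟩⟩ := h 1 hS
          · exact ht
          · exact (h rfl).elim
        · obtain ⟨t, ht, rfl | ⟨-, h, -⟩⟩ := h s hs
          · exact hT s ht
          · exact (h (hT t ht)).elim
        · obtain ⟨t, ht, rfl | ⟨-, h', h⟩⟩ := h s hs
          · exact hT s ht hs1
          · exact a.equiv.trans (hT t ht h') (a.equiv.symm h)
      obtain ⟨a1, a2, a3⟩ := key S T h1
      obtain ⟨b1, b2, b3⟩ := key T S h2
      have e2 : (∀ s ∈ S, s = 1) ↔ (∀ s ∈ T, s = 1) := ⟨b2, a2⟩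
      have e3 : (∀ s ∈ S, s ≠ 1 → a.r 0 s) ↔ (∀ s ∈ T, s ≠ 1 → a.r 0 s) := ⟨b3, a3⟩
      have e4 : sat r S = sat r T := sat_congr hr h1 h2
      by_cases hS : 1 ∈ S
      · have hT := a1 hS
        simp only [hS, hT, if_true]
        exact if_congr e2 rfl (if_congr e3 rfl (by rw [e4]))
      · have hT : 1 ∉ T := fun h => hS (b1 h)
        simp only [hS, hT, if_false]
        have hsub : ∀ s t, r s t → a.r s t := by
          rintro s t (rfl | ⟨-, -, h⟩)
          · exact a.equiv.refl _
          · exact h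
        exact a.inv S T (fun s hs => (h1 s hs).imp fun t ht => ⟨ht.1, hsub _ _ ht.2⟩)
          (fun s hs => (h2 s hs).imp fun t ht => ⟨ht.1, hsub _ _ ht.2⟩)
    sub := fun S h => by
      by_cases hS : 1 ∈ S
      · have : ∀ s ∈ S, s = 1 := fun s hs => by
          rcases h s hs 1 hS with h | ⟨-, h, -⟩
          · exact h
          · exact (h rfl).elim
        simp only [hS, if_true]
        rw [if_pos this]
      · simp only [hS, if_false]
        refine a.sub S fun s hs t ht => ?_
        rcases h s hs t ht with rfl | ⟨-, -, h⟩
        · exact a.equiv.refl _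
        · exact h
    con := fun h c hc => by
      classical
      have h02 : (0 : Fin (m + 3)) ≠ 2 := zero_ne_two_fin m
      have h01 : (0 : Fin (m + 3)) ≠ 1 := by simp
      have h12 : (1 : Fin (m + 3)) ≠ 2 := one_ne_two_fin m
      have m0 : (1 : Fin (m + 3)) ∈ ({0}ᶜ : Finset (Fin (m + 3))) := by simp
      have m2 : (1 : Fin (m + 3)) ∈ ({2}ᶜ : Finset (Fin (m + 3))) := by simpa using h12
      have n0 : ¬ ∀ s ∈ ({0}ᶜ : Finset (Fin (m + 3))), s = 1 := fun hs =>
        h12 (hs 2 (by simpa using h02.symm)).symm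
      have n2 : ¬ ∀ s ∈ ({2}ᶜ : Finset (Fin (m + 3))), s = 1 := fun hs =>
        h01 (hs 0 (by simpa using h02))
      have r0 : ¬ ∀ s ∈ ({0}ᶜ : Finset (Fin (m + 3))), s ≠ 1 → a.r 0 s := fun hs =>
        h02 (h 0 2 (Or.inr ⟨h01, h12.symm, hs 2 (by simpa using h02.symm) h12.symm⟩))
      have hc0 := hc 0
      have hc2 := hc 2
      rw [if_pos m0, if_neg n0, if_neg r0] at hc0
      rw [if_pos m2, if_neg n2] at hc2
      by_cases r2 : ∀ s ∈ ({2}ᶜ : Finset (Fin (m + 3))), s ≠ 1 → a.r 0 s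
      · rw [if_pos r2, ← hc0] at hc2
        simp at hc2
      · refine ⟨0, 2, h02, ?_⟩
        rw [if_pos m0, if_neg n0, if_neg r0, if_pos m2, if_neg n2, if_neg r2]
        refine ⟨rfl, ?_⟩
        rw [sat_eq_self hr h, sat_eq_self hr h]
        exact fun he => h02 (Finset.singleton_injective (compl_injective he)) }

theorem Pattern.extend_sim (v : ℕ) (a : Pattern.{u} (m + 3)) : Sim 1 (a.extend v) a := by
  constructor
  · intro j k hj hk
    refine ⟨?_, fun h => Or.inr ⟨hj, hk, h⟩⟩
    rintro (rfl | ⟨-, -, h⟩)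
    · exact a.equiv.refl _
    · exact h
  · intro S hS
    simp [Pattern.extend, hS]

theorem Pattern.Real.extend {a : Pattern.{u} (m + 3)} (ha : a.Real) (v : ℕ) :
    (a.extend v).Real := by
  intro S
  simp only [Pattern.extend]
  split_ifs
  · simp [defaultLabel]
  · simp
  · simp
  · exact ha S

theorem Pattern.extend_K (v : ℕ) (a : Pattern.{u} (m + 3)) :
    (a.extend v).K {0, 1} = (none, some (v + 1, ∅)) := by
  have h1 : (1 : Fin (m + 3)) ∈ ({0, 1} : Finset (Fin (m + 3))) := by simp
  have h2 : ¬ ∀ s ∈ ({0, 1} : Finset (Fin (m + 3))), s = 1 := fun h => by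
    simpa using h 0 (by simp)
  have h3 : ∀ s ∈ ({0, 1} : Finset (Fin (m + 3))), s ≠ 1 → a.r 0 s := fun s hs hs1 => by
    have : s = 0 := by simpa [hs1] using hs
    rw [this]
    exact a.equiv.refl _
  simp only [Pattern.extend]
  rw [if_pos h1, if_neg h2, if_pos h3]

/-- Cylindrification of sets of real patterns. -/
def realCyl {n : ℕ} (i : Fin n) (X : Set (RealPattern.{u} n)) : Set (RealPattern.{u} n) :=
  {a | ∃ b ∈ X, Sim i b.1 a.1}

/-- The real patterns in which the entries `i` and `j` coincide. -/
def realDiag {n : ℕ} (i j : Fin n) : Set (RealPattern.{u} n) := {a | a.1.r i j}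

/-- The real patterns in which the set of the entries `0` and `k` has the label number `v` in a
fixed infinite sequence. -/
def pairSet (k : Fin (m + 3)) (v : ℕ) : Set (RealPattern.{u} (m + 3)) :=
  {a | a.1.K {0, k} = (none, some (v + 1, ∅))}

/-- The finite information on the facet opposite to the entry `i` that matters for the restriction
on labels: real vertices with the same second component are not adjacent. -/
def facetClass {n : ℕ} (i : Fin n) (a : Pattern.{u} n) : Col n × Option (Finset (Fin n)) :=
  ((a.K {i}ᶜ).1, (a.K {i}ᶜ).2.map Prod.snd)

/-- The real patterns with a given class of the facet opposite to the entry `i`. -/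
def facetSet {n : ℕ} (i : Fin n) (κ : Col n × Option (Finset (Fin n))) :
    Set (RealPattern.{u} n) :=
  {a | facetClass i a.1 = κ}

theorem realCyl_realDiag {n : ℕ} {i j k : Fin n} (hi : k ≠ i) (hj : k ≠ j) :
    realCyl k (realDiag.{u} i j) ⊆ realDiag i j :=
  fun _ ⟨_, hb, h⟩ => (h.1 i j hi.symm hj.symm).1 hb

theorem realCyl_pairSet {j k : Fin (m + 3)} {v : ℕ} (h0 : k ≠ 0) (hj : k ≠ j) :
    realCyl k (pairSet.{u} j v) ⊆ pairSet j v := fun _ ⟨_, hb, h⟩ =>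
  (h.2 _ (by simp [h0, hj])).symm.trans hb

theorem realCyl_facetSet {n : ℕ} (i : Fin n) (κ : Col n × Option (Finset (Fin n))) :
    realCyl i (facetSet.{u} i κ) ⊆ facetSet i κ := fun a ⟨b, hb, h⟩ => by
  change facetClass i a.1 = κ
  rw [facetClass, ← h.2 _ (by simp)]
  exact hb

theorem realCyl_pairSet_self (v : ℕ) :
    realCyl 1 (pairSet.{u} (m := m) 1 v) = Set.univ :=
  Set.eq_univ_of_forall fun a => ⟨⟨a.1.extend v, a.2.extend v⟩, a.1.extend_K v, a.1.extend_sim v⟩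

theorem realCyl_realDiag_self {n : ℕ} {i j : Fin n} (h : i ≠ j) :
    realCyl j (realDiag.{u} i j) = Set.univ :=
  Set.eq_univ_of_forall fun a => ⟨⟨act (repl j i) a.1, a.2.act _⟩, by
    change a.1.r _ _
    simpa [Function.update_of_ne h] using a.1.equiv.refl i, sim_act_repl j i a.1⟩

theorem realDiag_symm {n : ℕ} (i j : Fin n) : realDiag.{u} i j ⊆ realDiag j i :=
  fun a h => a.1.equiv.symm h

theorem realDiag_trans {n : ℕ} (i j k : Fin n) :
    realDiag.{u} i j ∩ realDiag j k ⊆ realDiag i k :=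
  fun a h => a.1.equiv.trans h.1 h.2

theorem realDiag_inter_pairSet (j k : Fin (m + 3)) (v : ℕ) :
    realDiag.{u} j k ∩ pairSet j v ⊆ pairSet k v := fun a ⟨hr, hp⟩ => by
  change a.1.K _ = _
  rw [← hp]
  have h0 := a.1.equiv.refl 0
  apply a.1.inv
  · intro s hs
    rcases Finset.mem_insert.1 hs with rfl | hs
    · exact ⟨0, by simp, h0⟩
    · obtain rfl := Finset.mem_singleton.1 hs
      exact ⟨j, by simp, a.1.equiv.symm hr⟩
  · intro s hs
    rcases Finset.mem_insert.1 hs with rfl | hs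
    · exact ⟨0, by simp, h0⟩
    · obtain rfl := Finset.mem_singleton.1 hs
      exact ⟨k, by simp, hr⟩

/-- If two entries coincide, then the facets opposite to them are the same. -/
theorem realDiag_inter_facetSet {n : ℕ} (i j : Fin n) (κ : Col n × Option (Finset (Fin n))) :
    realDiag.{u} i j ∩ facetSet i κ ⊆ facetSet j κ := fun a ⟨hr, hp⟩ => by
  by_cases hij : i = j
  · rwa [← hij]
  · change facetClass j a.1 = κ
    rw [← hp, facetClass, a.1.inv {j}ᶜ {i}ᶜ]
    · rfl
    · intro s _
      by_cases hsi : s = i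
      · exact ⟨j, by simpa using Ne.symm hij, hsi ▸ hr⟩
      · exact ⟨s, by simpa using hsi, a.1.equiv.refl s⟩
    · intro s _
      by_cases hsj : s = j
      · exact ⟨i, by simpa using hij, hsj ▸ a.1.equiv.symm hr⟩
      · exact ⟨s, by simpa using hsj, a.1.equiv.refl s⟩

variable {n : ℕ} {U : Fin n → Type u}

theorem mem_map_inter (H : BoundedLatticeHom (Set (RealPattern.{u} n)) (Set (∀ k, U k)))
    {X Y : Set (RealPattern.{u} n)} {x : ∀ k, U k} (hX : x ∈ H X) (hY : x ∈ H Y) :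
    x ∈ H (X ∩ Y) := by
  have : H (X ∩ Y) = H X ∩ H Y := map_inf H X Y
  rw [this]
  exact ⟨hX, hY⟩

theorem mem_map_mono (H : BoundedLatticeHom (Set (RealPattern.{u} n)) (Set (∀ k, U k)))
    {X Y : Set (RealPattern.{u} n)} (h : X ⊆ Y) {x : ∀ k, U k} (hX : x ∈ H X) : x ∈ H Y :=
  OrderHomClass.mono H h hX

theorem mem_map_iInter (H : BoundedLatticeHom (Set (RealPattern.{u} n)) (Set (∀ k, U k)))
    {ι : Type*} [Finite ι] {X : ι → Set (RealPattern.{u} n)} {x : ∀ k, U k}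
    (h : ∀ i, x ∈ H (X i)) : x ∈ H (⋂ i, X i) := by
  have := Fintype.ofFinite ι
  have h1 : (⋂ i, X i) = Finset.univ.inf X := by
    rw [Finset.inf_univ_eq_iInf, Set.iInf_eq_iInter]
  rw [h1, map_finset_inf, Finset.inf_univ_eq_iInf, Set.iInf_eq_iInter, Set.mem_iInter]
  exact h

theorem exists_mem_map_of_iUnion
    (H : BoundedLatticeHom (Set (RealPattern.{u} n)) (Set (∀ k, U k)))
    {ι : Type*} [Finite ι] {X : ι → Set (RealPattern.{u} n)} (hX : ∀ a, ∃ i, a ∈ X i)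
    (x : ∀ k, U k) : ∃ i, x ∈ H (X i) := by
  have := Fintype.ofFinite ι
  have h1 : (⊤ : Set (RealPattern.{u} n)) = Finset.univ.sup X := by
    rw [Finset.sup_univ_eq_iSup, Set.iSup_eq_iUnion, Set.top_eq_univ, eq_comm,
      Set.eq_univ_iff_forall]
    exact fun a => Set.mem_iUnion.2 (hX a)
  have h2 : x ∈ H ⊤ := by
    rw [map_top]
    trivial
  rw [h1, map_finset_sup, Finset.sup_univ_eq_iSup, Set.iSup_eq_iUnion, Set.mem_iUnion] at h2
  exact h2

theorem not_mem_map_empty (H : BoundedLatticeHom (Set (RealPattern.{u} n)) (Set (∀ k, U k)))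
    (x : ∀ k, U k) : x ∉ H ∅ := by
  have : H ∅ = ∅ := map_bot H
  rw [this]
  exact fun h => h

theorem exists_update_mem (H : BoundedLatticeHom (Set (RealPattern.{u} n)) (Set (∀ k, U k)))
    (hH : ∀ i X, H (realCyl i X) = setCyl i (H X)) {i : Fin n} {X : Set (RealPattern.{u} n)}
    (hX : realCyl i X = Set.univ) (x : ∀ k, U k) : ∃ y, Function.update x i y ∈ H X := by
  have h : x ∈ H (realCyl i X) := by
    have : H Set.univ = Set.univ := map_top H
    rw [hX, this]
    trivial
  rw [hH] at h
  obtain ⟨y, hy, hyx⟩ := h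
  refine ⟨y i, ?_⟩
  convert hy
  funext k
  by_cases hk : k = i
  · subst hk; simp
  · rw [Function.update_of_ne hk, hyx k hk]

/-- If `X` is closed under the cylindrifications `c_i`, `i ∉ s`, then membership in the image of `X`
depends on the coordinates in `s` only. -/
theorem mem_map_of_agree (H : BoundedLatticeHom (Set (RealPattern.{u} n)) (Set (∀ k, U k)))
    (hH : ∀ i X, H (realCyl i X) = setCyl i (H X)) {X : Set (RealPattern.{u} n)}
    (s : Finset (Fin n)) (hX : ∀ i, i ∉ s → realCyl i X ⊆ X) {x y : ∀ k, U k} (hx : x ∈ H X)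
    (hxy : ∀ i ∈ s, y i = x i) : y ∈ H X := by
  classical
  have key : ∀ t : Finset (Fin n), t.piecewise y x ∈ H X := by
    intro t
    induction t using Finset.induction_on with
    | empty => simpa using hx
    | insert i t _ ih =>
      rw [Finset.piecewise_insert]
      by_cases his : i ∈ s
      · have : Function.update (t.piecewise y x) i (y i) = t.piecewise y x := by
          rw [Function.update_eq_self_iff]
          by_cases hit : i ∈ t
          · simp [hit]
          · simp [hit, hxy i his]
        rwa [this]
      · refine mem_map_mono H (hX i his) ?_
        rw [hH]
        exact ⟨_, ih, fun k hk => by rw [Function.update_of_ne hk]⟩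
  simpa using key Finset.univ

theorem mem_map_realDiag (H : BoundedLatticeHom (Set (RealPattern.{u} n)) (Set (∀ k, U k)))
    (hH : ∀ i X, H (realCyl i X) = setCyl i (H X)) {j k : Fin n} {x y : ∀ k, U k}
    (hx : x ∈ H (realDiag j k)) (hj : y j = x j) (hk : y k = x k) : y ∈ H (realDiag j k) :=
  mem_map_of_agree H hH {j, k} (fun i hi => by
    simp only [Finset.mem_insert, Finset.mem_singleton, not_or] at hi
    exact realCyl_realDiag hi.1 hi.2) hx (by simp [hj, hk])

theorem mem_map_pairSet {U : Fin (m + 3) → Type u}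
    (H : BoundedLatticeHom (Set (RealPattern.{u} (m + 3))) (Set (∀ k, U k)))
    (hH : ∀ i X, H (realCyl i X) = setCyl i (H X)) {k : Fin (m + 3)} {v : ℕ} {x y : ∀ k, U k}
    (hx : x ∈ H (pairSet k v)) (h0 : y 0 = x 0) (hk : y k = x k) : y ∈ H (pairSet k v) :=
  mem_map_of_agree H hH {0, k} (fun i hi => by
    simp only [Finset.mem_insert, Finset.mem_singleton, not_or] at hi
    exact realCyl_pairSet hi.1 hi.2) hx (by simp [h0, hk])

/-- In a representation there is an infinite sequence of tuples, each on all diagonals, such that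
coordinates of different members of the sequence are never identified by a diagonal. -/
theorem exists_distinct_points {U : Fin (m + 3) → Type u}
    (H : BoundedLatticeHom (Set (RealPattern.{u} (m + 3))) (Set (∀ k, U k)))
    (hH : ∀ i X, H (realCyl i X) = setCyl i (H X)) (w : ∀ k, U k) :
    ∃ u : ℕ → ∀ k, U k, (∀ v j k, u v ∈ H (realDiag j k)) ∧
      ∀ (x : ∀ k, U k) v v' j k, j ≠ k → x ∈ H (realDiag j k) → x j = u v j → x k = u v' k →
        v = v' := by
  have h01 : (0 : Fin (m + 3)) ≠ 1 := by simp
  choose y hy using fun v => exists_update_mem H hH (realCyl_pairSet_self v) w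
  have hz : ∀ v k, ∃ z : U k, ∀ x : ∀ k, U k, x 1 = y v → x k = z →
      x ∈ H (realDiag 1 k) := by
    intro v k
    by_cases hk : k = 1
    · subst hk
      refine ⟨y v, fun x _ _ => ?_⟩
      have : realDiag.{u} (1 : Fin (m + 3)) 1 = Set.univ :=
        Set.eq_univ_of_forall fun a => a.1.equiv.refl 1
      rw [this, show H Set.univ = Set.univ from map_top H]
      trivial
    · obtain ⟨z, hz⟩ := exists_update_mem H hH (realCyl_realDiag_self (Ne.symm hk))
        (Function.update w 1 (y v))
      refine ⟨z, fun x h1 hk' => mem_map_realDiag H hH hz ?_ ?_⟩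
      · rw [Function.update_of_ne (Ne.symm hk), Function.update_self, h1]
      · rw [Function.update_self, hk']
  choose z hz using hz
  -- The coordinate `1` of a member of the sequence is `y v`, and the diagonals identify the other
  -- coordinates with it. Different `y v` have different labels relative to `w 0`.
  let u : ℕ → ∀ k, U k := fun v => Function.update (z v) 1 (y v)
  have hu1 : ∀ v, u v 1 = y v := fun v => by simp [u]
  have hu1k : ∀ v k, u v ∈ H (realDiag 1 k) := by
    intro v k
    by_cases hk : k = 1
    · subst hk
      have : realDiag.{u} (1 : Fin (m + 3)) 1 = Set.univ :=
        Set.eq_univ_of_forall fun a => a.1.equiv.refl 1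
      rw [this, show H Set.univ = Set.univ from map_top H]
      trivial
    · exact hz v k _ (hu1 v) (Function.update_of_ne hk _ _)
  have hu : ∀ v j k, u v ∈ H (realDiag j k) := fun v j k =>
    mem_map_mono H (realDiag_trans j 1 k) (mem_map_inter H
      (mem_map_mono H (realDiag_symm 1 j) (hu1k v j)) (hu1k v k))
  have hP : ∀ v k, k ≠ 0 → Function.update w k (u v k) ∈ H (pairSet k v) := by
    intro v k hk0
    by_cases hk : k = 1
    · subst hk
      rw [hu1]
      exact hy v
    · let x := Function.update (Function.update w 1 (u v 1)) k (u v k)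
      have hx0 : x 0 = w 0 := by
        simp only [x]
        rw [Function.update_of_ne hk0.symm, Function.update_of_ne h01]
      have hx1 : x 1 = u v 1 := by
        simp only [x]
        rw [Function.update_of_ne (Ne.symm hk), Function.update_self]
      have hxk : x k = u v k := by simp [x]
      have h1 : x ∈ H (pairSet 1 v) := mem_map_pairSet H hH (hy v)
        (by rw [hx0, Function.update_of_ne h01]) (by rw [hx1, Function.update_self, hu1])
      have h2 : x ∈ H (realDiag 1 k) := mem_map_realDiag H hH (hu v 1 k) hx1 hxk
      exact mem_map_pairSet H hH (mem_map_mono H (realDiag_inter_pairSet 1 k v)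
        (mem_map_inter H h2 h1)) (by rw [hx0, Function.update_of_ne hk0.symm])
        (by rw [hxk, Function.update_self])
  have hB : ∀ (x : ∀ k, U k) v v' j k, j ≠ 0 → k ≠ 0 → j ≠ k → x ∈ H (realDiag j k) →
      x j = u v j → x k = u v' k → v = v' := by
    intro x v v' j k hj hk hjk hx hxj hxk
    let x' := Function.update x 0 (w 0)
    have hj' : x' j = x j := Function.update_of_ne hj _ _
    have hk' : x' k = x k := Function.update_of_ne hk _ _
    have h0 : x' 0 = w 0 := Function.update_self _ _ _
    have h1 : x' ∈ H (pairSet j v) := mem_map_pairSet H hH (hP v j hj)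
      (by rw [h0, Function.update_of_ne hj.symm]) (by rw [hj', hxj, Function.update_self])
    have h2 : x' ∈ H (pairSet k v') := mem_map_pairSet H hH (hP v' k hk)
      (by rw [h0, Function.update_of_ne hk.symm]) (by rw [hk', hxk, Function.update_self])
    have h3 : x' ∈ H (pairSet k v) := mem_map_mono H (realDiag_inter_pairSet j k v)
      (mem_map_inter H (mem_map_realDiag H hH hx hj' hk') h1)
    by_contra hne
    have hemp : pairSet.{u} k v ∩ pairSet k v' = ∅ := by
      rw [Set.eq_empty_iff_forall_notMem]
      rintro a ⟨ha, ha'⟩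
      have := (show a.1.K {0, k} = _ from ha).symm.trans ha'
      simp at this
      exact hne this
    have := mem_map_inter H h3 h2
    rw [hemp] at this
    exact not_mem_map_empty H _ this
  have hC : ∀ (x : ∀ k, U k) v v' k, k ≠ 0 → x ∈ H (realDiag 0 k) →
      x 0 = u v 0 → x k = u v' k → v = v' := by
    intro x v v' k hk hx hx0 hxk
    obtain ⟨l, hl0, hlk⟩ : ∃ l : Fin (m + 3), l ≠ 0 ∧ l ≠ k := by
      by_cases hk1 : k = 1
      · exact ⟨2, (zero_ne_two_fin m).symm, by rw [hk1]; exact (one_ne_two_fin m).symm⟩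
      · exact ⟨1, h01.symm, Ne.symm hk1⟩
    let x' := Function.update x l (u v l)
    have h0 : x' 0 = x 0 := Function.update_of_ne hl0.symm _ _
    have hk' : x' k = x k := Function.update_of_ne hlk.symm _ _
    have hl : x' l = u v l := Function.update_self _ _ _
    refine hB x' v v' l k hl0 hk hlk (mem_map_mono H (realDiag_trans l 0 k) (mem_map_inter H ?_ ?_))
      hl (hk'.trans hxk)
    · exact mem_map_realDiag H hH (hu v l 0) hl (h0.trans hx0)
    · exact mem_map_realDiag H hH hx h0 hk'
  refine ⟨u, hu, fun x v v' j k hjk hx hxj hxk => ?_⟩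
  by_cases hj : j = 0
  · subst hj
    exact hC x v v' k hjk.symm hx hxj hxk
  · by_cases hk : k = 0
    · subst hk
      exact (hC x v' v j hj (mem_map_mono H (realDiag_symm j 0) hx) hxk hxj).symm
    · exact hB x v v' j k hj hk hjk hx hxj hxk

/-- A function of tuples `g` and indices `i` that does not depend on the entry `i`, and that takes
the same value at indices with equal entries, is a function of the facets of `g`. -/
theorem eq_facet_function {κ : Type*} {N : ℕ} (cls : (Fin (N + 1) → ℕ) → Fin (N + 1) → κ)
    (h1 : ∀ g i v, cls (Function.update g i v) i = cls g i)
    (h2 : ∀ g i j, g i = g j → cls g i = cls g j) (i : Fin (N + 1)) (g : Fin (N + 1) → ℕ) :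
    cls g i = cls (Fin.snoc (α := fun _ => ℕ) (fun k => g (i.succAbove k)) 0) (Fin.last N) := by
  induction i using Fin.reverseInduction generalizing g with
  | last =>
    rw [← h1 g (Fin.last N) 0]
    congr 1
    funext k
    refine Fin.lastCases ?_ (fun k => ?_) k
    · simp
    · rw [Function.update_of_ne (Fin.castSucc_lt_last k).ne]
      simp
  | cast j ih =>
    let g' := Function.update g j.castSucc (g j.succ)
    have hne : j.succ ≠ j.castSucc := (Fin.castSucc_lt_succ (i := j)).ne'
    have e : g' j.castSucc = g' j.succ := by
      simp only [g', Function.update_self, Function.update_of_ne hne]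
    rw [← h1 g j.castSucc (g j.succ), h2 _ _ _ e, ih g']
    congr 2
    funext k
    by_cases hkj : k = j
    · subst hkj
      simp [g']
    · have : j.succ.succAbove k = j.castSucc.succAbove k := by
        rcases lt_or_gt_of_ne hkj with h | h
        · have h := Fin.lt_def.1 h
          have h1 : k.castSucc < j.succ := Nat.lt_succ_of_lt h
          have h2 : k.castSucc < j.castSucc := h
          rw [Fin.succAbove_of_castSucc_lt _ _ h1, Fin.succAbove_of_castSucc_lt _ _ h2]
        · have h := Fin.lt_def.1 h
          have h1 : j.succ ≤ k.castSucc := Nat.succ_le_of_lt h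
          have h2 : j.castSucc ≤ k.castSucc := Nat.le_of_lt h
          rw [Fin.succAbove_of_le_castSucc _ _ h1, Fin.succAbove_of_le_castSucc _ _ h2]
      rw [this]
      exact Function.update_of_ne (Fin.succAbove_ne _ _) _ _

/-- The Ramsey argument: the facets of tuples formed from an infinite sequence of points are
coloured with finitely many classes, so some tuple of distinct points has all its facets in the same
class. No real pattern is like this. -/
theorem not_representable {U : Fin (m + 3) → Type u}
    (H : BoundedLatticeHom (Set (RealPattern.{u} (m + 3))) (Set (∀ k, U k)))
    (hH : ∀ i X, H (realCyl i X) = setCyl i (H X)) (w : ∀ k, U k) : False := by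
  obtain ⟨u, hu, hdist⟩ := exists_distinct_points H hH w
  have hex : ∀ (g : Fin (m + 3) → ℕ) i, ∃ κ, (fun k => u (g k) k) ∈ H (facetSet i κ) :=
    fun g i => exists_mem_map_of_iUnion H (fun a => ⟨facetClass i a.1, rfl⟩) _
  choose cls hcls using hex
  have huniq : ∀ (x : ∀ k, U k) i κ κ', x ∈ H (facetSet i κ) → x ∈ H (facetSet i κ') →
      κ = κ' := by
    intro x i κ κ' h h'
    by_contra hne
    have hemp : facetSet.{u} i κ ∩ facetSet i κ' = ∅ := by
      rw [Set.eq_empty_iff_forall_notMem]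
      rintro a ⟨ha, ha'⟩
      exact hne ((show facetClass i a.1 = _ from ha).symm.trans ha')
    have := mem_map_inter H h h'
    rw [hemp] at this
    exact not_mem_map_empty H _ this
  have h1 : ∀ g i v, cls (Function.update g i v) i = cls g i := by
    intro g i v
    refine huniq _ i _ _ (hcls _ i) (mem_map_of_agree H hH {i}ᶜ (fun k hk => ?_) (hcls g i) ?_)
    · obtain rfl : k = i := by simpa using hk
      exact realCyl_facetSet k _
    · intro k hk
      have hk : k ≠ i := by simpa using hk
      rw [Function.update_of_ne hk]
  have h2 : ∀ g i j, g i = g j → cls g i = cls g j := by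
    intro g i j hij
    refine huniq _ j _ _ (mem_map_mono H (realDiag_inter_facetSet i j _)
      (mem_map_inter H ?_ (hcls g i))) (hcls g j)
    exact mem_map_realDiag H hH (hu (g i) i j) rfl (by rw [hij])
  obtain ⟨g, hg, c, hc⟩ := exists_monochromatic_facets (m + 2)
    fun a => cls (Fin.snoc (α := fun _ => ℕ) a 0) (Fin.last (m + 2))
  have hcg : ∀ i, cls g i = c := fun i => (eq_facet_function cls h1 h2 i g).trans (hc i)
  let x : ∀ k, U k := fun k => u (g k) k
  have hx1 : x ∈ H (⋂ i, facetSet i c) := mem_map_iInter H fun i => hcg i ▸ hcls g i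
  have hx2 : x ∈ H (⋂ p : {p : Fin (m + 3) × Fin (m + 3) // p.1 ≠ p.2},
      (realDiag p.1.1 p.1.2)ᶜ) := by
    refine mem_map_iInter H fun p => ?_
    rw [show H (realDiag p.1.1 p.1.2)ᶜ = (H (realDiag p.1.1 p.1.2))ᶜ from map_compl' H _]
    intro h
    exact p.2 (hg (hdist x _ _ _ _ p.2 h rfl rfl))
  have hemp : (⋂ i, facetSet.{u} i c) ∩ (⋂ p : {p : Fin (m + 3) × Fin (m + 3) // p.1 ≠ p.2},
      (realDiag p.1.1 p.1.2)ᶜ) = ∅ := by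
    rw [Set.eq_empty_iff_forall_notMem]
    rintro a ⟨ha, ha'⟩
    rw [Set.mem_iInter] at ha ha'
    have hf : ∀ i, facetClass i a.1 = c := ha
    obtain ⟨i, j, -, hadj⟩ := a.1.con (fun i j hij => by
      by_contra hne
      exact ha' ⟨(i, j), hne⟩ hij) c.1 (fun i => congrArg Prod.fst (hf i))
    have hsnd := (congrArg Prod.snd (hf i)).trans (congrArg Prod.snd (hf j)).symm
    simp only [facetClass] at hsnd
    rcases hi : (a.1.K {i}ᶜ).2 with _ | ⟨k, S⟩
    · exact a.2 _ hi
    · rcases hj : (a.1.K {j}ᶜ).2 with _ | ⟨l, T⟩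
      · exact a.2 _ hj
      · rw [hi, hj] at hadj hsnd
        exact hadj.2 (by simpa using hsnd)
  have := mem_map_inter H hx1 hx2
  rw [hemp] at this
  exact not_mem_map_empty H _ this

theorem rdDf_realAlg_notMem (m : ℕ) : rdDf (realAlg.{u} (m + 3)) ∉ RDf (m + 3) := by
  rintro ⟨I, B, h, hB, -, hinj⟩
  let a : Pattern.{u} (m + 3) := fill 0 (Pattern.const (by omega))
  have hne : ¬ ∀ i, h i ⊥ = h i ⊤ := fun hall => by
    have : (∅ : Set (RealPattern.{u} (m + 3))) = Set.univ := hinj _ _ hall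
    exact (this ▸ Set.mem_univ (⟨a, fill_real _ _⟩ : RealPattern.{u} (m + 3)) :
      _ ∈ (∅ : Set (RealPattern.{u} (m + 3))))
  push Not at hne
  obtain ⟨i, hi⟩ := hne
  obtain ⟨_, ⟨U, rfl⟩, e, he⟩ := hB i
  let H : BoundedLatticeHom (Set (RealPattern.{u} (m + 3))) (Set (∀ k, U k)) :=
    e.toBoundedLatticeHom.comp (h i).toBoundedLatticeHom
  have hH : ∀ j X, H (realCyl j X) = setCyl j (H X) := fun j X => by
    have h1 := (h i).map_op (CylOp.c j) X
    have h2 := e.map_op (CylOp.c j) ((h i) X)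
    exact (congrArg e h1).trans h2
  rcases Set.eq_empty_or_nonempty (Set.univ : Set (∀ k, U k)) with hU | ⟨w, -⟩
  · refine hi (he ?_)
    have hsub : ∀ X Y : Set (∀ k, U k), X = Y := fun X Y => by
      ext x
      exact absurd (Set.mem_univ x) (by rw [hU]; exact fun h => h)
    exact hsub _ _
  · exact not_representable H hH w

end NotRepresentable
/-! ### Reducts -/

namespace Alg

variable {S T : Sig}

/-- A homomorphism is a homomorphism of the reducts. -/
def Hom.reduct (f : S.Op → T.Op) (g : S.Const → T.Const) {A B : Alg.{u} T} (h : Hom A B) :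
    Hom (A.reduct f g) (B.reduct f g) where
  toFun := h.toFun
  map_sup' := h.map_sup'
  map_inf' := h.map_inf'
  map_top' := h.map_top'
  map_bot' := h.map_bot'
  map_op o := h.map_op (f o)
  map_const k := h.map_const (g k)

theorem IsCompletion.reduct (f : S.Op → T.Op) (g : S.Const → T.Const) {A C : Alg.{u} T}
    (h : IsCompletion A C) : IsCompletion (A.reduct f g) (C.reduct f g) := by
  obtain ⟨hc, ha, e, he, hd⟩ := h
  exact ⟨hc, fun o => ha (f o), e.reduct f g, he, hd⟩

/-- Reducts of representable algebras are representable if the reducts of the generating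
algebras embed into generating algebras of the smaller type. -/
theorem reduct_mem_subdirectProductsOf (f : S.Op → T.Op) (g : S.Const → T.Const)
    {K : Set (Alg.{u} T)} {K' : Set (Alg.{u} S)}
    (hK : ∀ B ∈ K, ∃ B' ∈ K', ∃ e : Hom (B.reduct f g) B', Function.Injective e) {A : Alg.{u} T}
    (hA : A ∈ SubdirectProductsOf (SubalgebrasOf K)) :
    A.reduct f g ∈ SubdirectProductsOf (SubalgebrasOf K') := by
  obtain ⟨I, B, h, hB, hs, hi⟩ := hA
  refine ⟨I, fun i => (B i).reduct f g, fun i => (h i).reduct f g, fun i => ?_, hs, hi⟩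
  obtain ⟨D, hD, e, he⟩ := hB i
  obtain ⟨D', hD', e', he'⟩ := hK D hD
  exact ⟨D', hD',
    { toFun := fun x => e'.toFun (e.toFun x)
      map_sup' := fun a b => (congrArg e'.toFun (e.map_sup' a b)).trans (e'.map_sup' _ _)
      map_inf' := fun a b => (congrArg e'.toFun (e.map_inf' a b)).trans (e'.map_inf' _ _)
      map_top' := (congrArg e'.toFun e.map_top').trans e'.map_top'
      map_bot' := (congrArg e'.toFun e.map_bot').trans e'.map_bot'
      map_op := fun o a => (congrArg e'.toFun (e.map_op (f o) a)).trans (e'.map_op o _)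
      map_const := fun k => (congrArg e'.toFun (e.map_const (g k))).trans (e'.map_const k) },
    he'.comp he⟩

end Alg

variable {n : ℕ}

theorem rdCA_mem {A : Alg.{u} (sigPEA n)} (h : A ∈ RPEA n) : rdCA A ∈ RCA n := by
  refine Alg.reduct_mem_subdirectProductsOf _ _ ?_ h
  rintro _ ⟨U, rfl⟩
  exact ⟨_, ⟨U, rfl⟩,
    { toFun := id
      map_sup' := fun _ _ => rfl
      map_inf' := fun _ _ => rfl
      map_top' := rfl
      map_bot' := rfl
      map_op := fun o _ => by cases o; rfl
      map_const := fun _ => rfl }, Function.injective_id⟩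

theorem rdPA_mem {A : Alg.{u} (sigPEA n)} (h : A ∈ RPEA n) : rdPA A ∈ RPA n := by
  refine Alg.reduct_mem_subdirectProductsOf _ _ ?_ h
  rintro _ ⟨U, rfl⟩
  exact ⟨_, ⟨U, rfl⟩,
    { toFun := id
      map_sup' := fun _ _ => rfl
      map_inf' := fun _ _ => rfl
      map_top' := rfl
      map_bot' := rfl
      map_op := fun _ _ => rfl
      map_const := fun k => k.elim }, Function.injective_id⟩

/-- The diagonal-free reduct of a representable cylindric algebra is representable. -/
theorem reduct_mem_RDf_of_RCA {A : Alg.{u} (sigCA n)} (h : A ∈ RCA n) :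
    Alg.reduct (S := sigDf n) (T := sigCA n) id Empty.elim A ∈ RDf n := by
  refine Alg.reduct_mem_subdirectProductsOf _ _ ?_ h
  rintro _ ⟨U, rfl⟩
  exact ⟨_, ⟨fun _ => U, rfl⟩,
    { toFun := id
      map_sup' := fun _ _ => rfl
      map_inf' := fun _ _ => rfl
      map_top' := rfl
      map_bot' := rfl
      map_op := fun o _ => by cases o; rfl
      map_const := fun k => k.elim }, Function.injective_id⟩

/-- The diagonal-free reduct of a representable polyadic algebra is representable. -/
theorem reduct_mem_RDf_of_RPA {A : Alg.{u} (sigPA n)} (h : A ∈ RPA n) :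
    Alg.reduct (S := sigDf n) (T := sigPA n) cylToPoly Empty.elim A ∈ RDf n := by
  refine Alg.reduct_mem_subdirectProductsOf _ _ ?_ h
  rintro _ ⟨U, rfl⟩
  exact ⟨_, ⟨fun _ => U, rfl⟩,
    { toFun := id
      map_sup' := fun _ _ => rfl
      map_inf' := fun _ _ => rfl
      map_top' := rfl
      map_bot' := rfl
      map_op := fun o _ => by cases o; rfl
      map_const := fun k => k.elim }, Function.injective_id⟩

theorem rdDf_eq_reduct_rdCA (A : Alg.{u} (sigPEA n)) :
    rdDf A = Alg.reduct (S := sigDf n) (T := sigCA n) id Empty.elim (rdCA A) := by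
  unfold rdDf rdCA Alg.reduct
  congr 1

theorem rdDf_eq_reduct_rdPA (A : Alg.{u} (sigPEA n)) :
    rdDf A = Alg.reduct (S := sigDf n) (T := sigPA n) cylToPoly Empty.elim (rdPA A) := by
  unfold rdDf rdPA Alg.reduct
  congr 1
  funext k
  exact k.elim

theorem rdDf_mem_of_rdCA_mem {A : Alg.{u} (sigPEA n)} (h : rdCA A ∈ RCA n) : rdDf A ∈ RDf n := by
  rw [rdDf_eq_reduct_rdCA]
  exact reduct_mem_RDf_of_RCA h

theorem rdDf_mem_of_rdPA_mem {A : Alg.{u} (sigPEA n)} (h : rdPA A ∈ RPA n) : rdDf A ∈ RDf n := by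
  rw [rdDf_eq_reduct_rdPA]
  exact reduct_mem_RDf_of_RPA h

end AlgLogic

theorem mainTheorem2 (n : ℕ) (hn : 3 ≤ n) :
    (¬ AlgLogic.Alg.ClosedUnderCompletions (AlgLogic.RCA.{u} n) ∧
      ¬ AlgLogic.Alg.ClosedUnderCompletions (AlgLogic.RPEA.{u} n) ∧
      ¬ AlgLogic.Alg.ClosedUnderCompletions (AlgLogic.RPA.{u} n) ∧
      ¬ AlgLogic.Alg.ClosedUnderCompletions (AlgLogic.RDf.{u} n)) ∧
    ∃ A C : AlgLogic.Alg.{u} (AlgLogic.sigPEA n),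
      Countable A ∧ IsAtomic A ∧
      (A ∈ AlgLogic.RPEA n ∧ AlgLogic.Alg.IsCompletion A C ∧ C ∉ AlgLogic.RPEA n) ∧
      (AlgLogic.rdCA A ∈ AlgLogic.RCA n ∧
        AlgLogic.Alg.IsCompletion (AlgLogic.rdCA A) (AlgLogic.rdCA C) ∧
        AlgLogic.rdCA C ∉ AlgLogic.RCA n) ∧
      (AlgLogic.rdPA A ∈ AlgLogic.RPA n ∧
        AlgLogic.Alg.IsCompletion (AlgLogic.rdPA A) (AlgLogic.rdPA C) ∧
        AlgLogic.rdPA C ∉ AlgLogic.RPA n) ∧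
      (AlgLogic.rdDf A ∈ AlgLogic.RDf n ∧
        AlgLogic.Alg.IsCompletion (AlgLogic.rdDf A) (AlgLogic.rdDf C) ∧
        AlgLogic.rdDf C ∉ AlgLogic.RDf n) := by
  have h0 : n ≠ 0 := by omega
  obtain ⟨U, e, he⟩ := AlgLogic.exists_approxAlg_embedding.{u} hn h0
  have hA : AlgLogic.approxAlg.{u} n h0 ∈ AlgLogic.RPEA n :=
    AlgLogic.Alg.mem_subdirectProductsOf ⟨U, rfl⟩ e he
  have hcomp := AlgLogic.realAlg_isCompletion.{u} n h0
  have hDf : AlgLogic.rdDf (AlgLogic.realAlg.{u} n) ∉ AlgLogic.RDf n := by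
    obtain ⟨m, rfl⟩ := Nat.exists_eq_add_of_le' hn
    exact AlgLogic.rdDf_realAlg_notMem m
  have hCA : AlgLogic.rdCA (AlgLogic.realAlg.{u} n) ∉ AlgLogic.RCA n :=
    fun h => hDf (AlgLogic.rdDf_mem_of_rdCA_mem h)
  have hPA : AlgLogic.rdPA (AlgLogic.realAlg.{u} n) ∉ AlgLogic.RPA n :=
    fun h => hDf (AlgLogic.rdDf_mem_of_rdPA_mem h)
  have hPEA : AlgLogic.realAlg.{u} n ∉ AlgLogic.RPEA n := fun h => hCA (AlgLogic.rdCA_mem h)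
  have hCA' := AlgLogic.rdCA_mem hA
  have hPA' := AlgLogic.rdPA_mem hA
  have hDf' := AlgLogic.rdDf_mem_of_rdCA_mem hCA'
  have cCA : AlgLogic.Alg.IsCompletion (AlgLogic.rdCA _) (AlgLogic.rdCA _) := hcomp.reduct _ _
  have cPA : AlgLogic.Alg.IsCompletion (AlgLogic.rdPA _) (AlgLogic.rdPA _) := hcomp.reduct _ _
  have cDf : AlgLogic.Alg.IsCompletion (AlgLogic.rdDf _) (AlgLogic.rdDf _) := hcomp.reduct _ _
  refine ⟨⟨fun h => hCA (h _ hCA' _ cCA), fun h => hPEA (h _ hA _ hcomp),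
    fun h => hPA (h _ hPA' _ cPA), fun h => hDf (h _ hDf' _ cDf)⟩,
    AlgLogic.approxAlg n h0, AlgLogic.realAlg n,
    inferInstanceAs (Countable (AlgLogic.approxSets.{u} n)), AlgLogic.approxAlg_isAtomic n h0,
    ⟨hA, hcomp, hPEA⟩, ⟨hCA', cCA, hCA⟩, ⟨hPA', cPA, hPA⟩, ⟨hDf', cDf, hDf⟩⟩
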